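/- Let $d,d_1\ge 0$, $K\ge 2$, $n\ge 1$ be integers, let $\mathcal D$ be a probability distribution on $\mathbb R^d\times[K]$, let $\epsilon\ge 0$, $s_1,s_2>0$, $b_1,b_2\in\mathbb R$, $\gamma>0$, $\delta\in(0,1)$, and let $(\mathbf x_1,y_1),\dots,(\mathbf x_n,y_n)$ be drawn i.i.d. from $\mathcal D$. Put $\mathbf X=[\mathbf x_1,\dots,\mathbf x_n]\in\mathbb R^{d\times n}$ and $d_{\max}=\max\{d,d_1,K\}$. For $\mathbf W=(\mathbf W_1,\mathbf W_2)$ with $\mathbf W_1\in\mathbb R^{d_1\times d}$, $\mathbf W_2\in\mathbb R^{K\times d_1}$ let $f_{\mathbf W}(\mathbf x)=\mathbf W_2\,\rho(\mathbf W_1\mathbf x)$, where $\rho(t)=\max\{t,0\}$ acts coordinatewise, and let $\mathbf w_{2,k}\in\mathbb R^{d_1}$ be the $k$-th row of $\mathbf W_2$. For $\mathbf v\in\mathbb R^{d_1}$ and $\mathbf W\in\mathbb R^{d_1\times d}$ let $$Q(\mathbf v,\mathbf W)=\begin{bmatrix}0&\mathbf 1^\top\operatorname{diag}(\mathbf v)\mathbf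 W&0\\ \mathbf W^\top\operatorname{diag}(\mathbf v)\mathbf 1&0&\mathbf W^\top\operatorname{diag}(\mathbf v)\\ 0&\operatorname{diag}(\mathbf v)\mathbf W&0\end{bmatrix}\in\mathbb R^{(1+d+d_1)\times(1+d+d_1)},$$ and let $$\Theta(\mathbf W)=\max_{k\in[K],\,z=\pm1}\ \max_{\mathbf P\succeq0,\ \operatorname{diag}(\mathbf P)\le 1}\langle zQ(\mathbf w_{2,k},\mathbf W_1),\mathbf P\rangle .$$ Let $\mathcal F$ be the class of all $f_{\mathbf W}$ with spectral norms $\|\mathbf W_1\|_\sigma\le s_1$, $\|\mathbf W_2\|_\sigma\le s_2$, entrywise $\ell_1$ norm $\|\mathbf W_1\|_1\le b_1$, and $\|\mathbf W_2^\top\|_{2,1}=\sum_{k}\|\mathbf w_{2,k}\|_2\le b_2$. Then, with probability at least $1-\delta$ over the sample, for all $f_{\mathbf W}\in\mathcal F$ simultaneously, $$\begin{aligned}&\mathbb P_{(\mathbf x,y)\sim\mathcal D}\Big\{\exists\,\mathbf x'\in\mathbb R^d,\ \|\mathbf x'-\mathbf x\|_\infty\le\epsilon,\ \text{s.t. } y\ne\arg\max_{y'\in[K]}[f_{\mathbf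 W}(\mathbf x')]_{y'}\Big\}\\ &\le\frac1n\sum_{i=1}^n\mathbf 1\Big([f_{\mathbf W}(\mathbf x_i)]_{y_i}\le\gamma+\max_{y'\ne y_i}[f_{\mathbf W}(\mathbf x_i)]_{y'}+\frac\epsilon2\Theta(\mathbf W)\Big)\\ &\quad+\frac1\gamma\bigg(\frac4{n^{3/2}}+\frac{60\log(n)\log(2d_{\max})}{n}\,s_1s_2\Big(\big(\tfrac{b_1}{s_1}\big)^{2/3}+\big(\tfrac{b_2}{s_2}\big)^{2/3}\Big)^{3/2}\|\mathbf X\|_F+\frac{2\epsilon b_1b_2}{\sqrt n}\bigg)+3\sqrt{\frac{\log(2/\delta)}{2n}}.\end{aligned}$$ Here $y=\arg\max_{y'}z_{y'}$ means $z_y>\max_{y'\ne y}z_{y'}$, so ties count as misclassifications. -/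

import Mathlib

open MeasureTheory
open scoped Matrix

namespace AdvSDP

noncomputable section

/-- Spectral norm of a real matrix: the operator norm between Euclidean spaces. -/
def spectralNorm {m n : ℕ} (A : Matrix (Fin m) (Fin n) ℝ) : ℝ :=
  ‖(Matrix.toEuclideanLin (𝕜 := ℝ) A).toContinuousLinearMap‖

/-- Entrywise `ℓ₁` norm. -/
def entryNormOne {m n : ℕ} (A : Matrix (Fin m) (Fin n) ℝ) : ℝ :=
  ∑ i, ∑ j, |A i j|

/-- The `(2,1)` norm: the sum of the Euclidean norms of the columns. -/
def normTwoOne {m n : ℕ} (A : Matrix (Fin m) (Fin n) ℝ) : ℝ :=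
  ∑ j, √(∑ i, A i j ^ 2)

/-- Frobenius norm of the data matrix whose columns are `x 0, …, x (n - 1)`. -/
def frobData {d n : ℕ} (x : Fin n → Fin d → ℝ) : ℝ :=
  √(∑ i, ∑ j, x i j ^ 2)

/-- One-hidden-layer ReLU network `x ↦ W₂ ρ(W₁ x)`. -/
def net {d d₁ K : ℕ} (W₁ : Matrix (Fin d₁) (Fin d) ℝ) (W₂ : Matrix (Fin K) (Fin d₁) ℝ)
    (x : Fin d → ℝ) : Fin K → ℝ :=
  W₂ *ᵥ (fun j => max ((W₁ *ᵥ x) j) 0)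

/-- The norm constraints that define the hypothesis class. -/
def InClass {d d₁ K : ℕ} (s₁ s₂ b₁ b₂ : ℝ)
    (W₁ : Matrix (Fin d₁) (Fin d) ℝ) (W₂ : Matrix (Fin K) (Fin d₁) ℝ) : Prop :=
  spectralNorm W₁ ≤ s₁ ∧ spectralNorm W₂ ≤ s₂ ∧ entryNormOne W₁ ≤ b₁ ∧ normTwoOne W₂ᵀ ≤ b₂

/-- `max_{y' ≠ y} z_{y'}`; used only with at least two classes. -/
def maxOther {K : ℕ} (z : Fin K → ℝ) (y : Fin K) : ℝ :=
  ⨆ y' : {y' : Fin K // y' ≠ y}, z y'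

/-- The score vector `z` predicts the label `y` (`y = argmax z`): the margin
`z_y - max_{y' ≠ y} z_{y'}` is positive, so that ties count as errors. -/
def Predicts {K : ℕ} (z : Fin K → ℝ) (y : Fin K) : Prop :=
  0 < z y - maxOther z y

/-- The pairs `(x, y)` for which some perturbation of `x` in the closed `ℓ_∞` ball of radius `ε`
is misclassified (the distance on `Fin d → ℝ` is the sup distance). -/
def advError {d K : ℕ} (f : (Fin d → ℝ) → Fin K → ℝ) (ε : ℝ) : Set ((Fin d → ℝ) × Fin K) :=
  {p | ∃ x' ∈ Metric.closedBall p.1 ε, ¬ Predicts (f x') p.2}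

/-- The symmetric matrix `Q(v, W)` of the quadratic form
`(a, t, s) ↦ 2 (a 𝟏 + s)ᵀ diag(v) W t` on `ℝ × ℝ^d × ℝ^{d₁}`. -/
def Q {d d₁ : ℕ} (v : Fin d₁ → ℝ) (W : Matrix (Fin d₁) (Fin d) ℝ) :
    Matrix (Unit ⊕ (Fin d ⊕ Fin d₁)) (Unit ⊕ (Fin d ⊕ Fin d₁)) ℝ :=
  let B : Matrix (Fin d₁) (Fin d) ℝ := Matrix.diagonal v * W
  let r : Matrix Unit (Fin d) ℝ := Matrix.replicateRow Unit (1 ᵥ* B)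
  Matrix.fromBlocks
    0                          (Matrix.fromCols r 0)
    (Matrix.fromRows rᵀ 0)     (Matrix.fromBlocks 0 Bᵀ B 0)

/-- `max ⟨A, P⟩` over positive semidefinite `P` with diagonal entries at most `1`
(a maximum over a nonempty compact set), where `⟨A, P⟩ = ∑ᵢⱼ Aᵢⱼ Pᵢⱼ`. -/
def sdpMax {ι : Type} [Fintype ι] (A : Matrix ι ι ℝ) : ℝ :=
  sSup {r | ∃ P : Matrix ι ι ℝ, P.PosSemidef ∧ (∀ i, P i i ≤ 1) ∧ r = ∑ i, ∑ j, A i j * P i j}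

/-- `max_{k, z = ±1} max_P ⟨z Q(w_{2,k}, W₁), P⟩`, with `w_{2,k}` the `k`-th row of `W₂`. -/
def sdpTerm {d d₁ K : ℕ} (W₁ : Matrix (Fin d₁) (Fin d) ℝ) (W₂ : Matrix (Fin K) (Fin d₁) ℝ) : ℝ :=
  ⨆ k : Fin K, max (sdpMax (Q (W₂ k) W₁)) (sdpMax (-(Q (W₂ k) W₁)))

open Classical in
/-- Fraction of the sample on which the margin reduced by the SDP term is at most `γ`. -/
def surrogateError {d d₁ K n : ℕ} (ε γ : ℝ) (W₁ : Matrix (Fin d₁) (Fin d) ℝ)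
    (W₂ : Matrix (Fin K) (Fin d₁) ℝ) (S : Fin n → (Fin d → ℝ) × Fin K) : ℝ :=
  (1 / (n : ℝ)) * ∑ i, if net W₁ W₂ (S i).1 (S i).2 ≤
      γ + maxOther (net W₁ W₂ (S i).1) (S i).2 + ε / 2 * sdpTerm W₁ W₂ then (1 : ℝ) else 0

end

end AdvSDP

/-!
Let `x' = x + ε t` with `|tⱼ| ≤ 1`. Each hidden unit changes by the change of its preactivation
times a secant slope `(1 + uᵢ) / 2` with `|uᵢ| ≤ 1`, so each score changes by `ε / 4` times the
pairing of `Q` with the rank-one feasible point `p pᵀ`, `p = (1, t, u)`, hence by at most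
`ε / 4 * sdpTerm W₁ W₂`. An adversarial error therefore forces the margin reduced by
`ε / 2 * sdpTerm W₁ W₂` to be nonpositive, and it suffices to prove a uniform law of large numbers
for the ramp loss of the reduced margin.

The deviation is controlled by the bounded differences inequality and symmetrization. In the
Rademacher average the ramp is removed by contraction, and the semidefinite term is replaced by a
free parameter in `[0, 4 b₁ b₂]`, which enlarges the class but costs only `O(ε b₁ b₂ √n)`. The
margins are handled by Dudley chaining: in each layer the weight matrix is, up to scale, a convex
combination of signed matrix units, and Maurey's empirical method approximates it by the mean of
`k` of them with error `O(1 / √k)`. For `n ≤ 3` the last term of the bound is at least `1`.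
-/

namespace AdvSDP

open ProbabilityTheory
open scoped BigOperators NNReal

/-! ### The bounded differences inequality -/

section BoundedDifferences

lemma integrable_of_forall_abs_le {Ω : Type*} [MeasurableSpace Ω] {ν : Measure Ω}
    [IsFiniteMeasure ν] {f : Ω → ℝ} (hf : Measurable f) {C : ℝ} (hC : ∀ x, |f x| ≤ C) :
    Integrable f ν :=
  .of_bound hf.aestronglyMeasurable C (.of_forall hC)

lemma integrable_exp_of_forall_abs_le {Ω : Type*} [MeasurableSpace Ω] {ν : Measure Ω}
    [IsFiniteMeasure ν] {f : Ω → ℝ} (hf : Measurable f) {C : ℝ} (hC : ∀ x, |f x| ≤ C) :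
    Integrable (fun x => Real.exp (f x)) ν :=
  integrable_of_forall_abs_le (by fun_prop) fun x => by
    rw [Real.abs_exp]
    exact Real.exp_le_exp.2 ((le_abs_self _).trans (hC x))

lemma abs_integral_le_of_forall_abs_le {Ω : Type*} [MeasurableSpace Ω] {ν : Measure Ω}
    [IsProbabilityMeasure ν] {f : Ω → ℝ} {C : ℝ} (hC : ∀ x, |f x| ≤ C) : |∫ x, f x ∂ν| ≤ C := by
  simpa using norm_integral_le_of_norm_le_const (μ := ν) (f := f) (.of_forall hC)

lemma hasSubgaussianMGF_of_forall_abs_sub_le {Ω : Type*} [MeasurableSpace Ω] {ν : Measure Ω}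
    [IsProbabilityMeasure ν] {f : Ω → ℝ} (hf : Measurable f) {c : ℝ≥0}
    (hc : ∀ x y, |f x - f y| ≤ c) :
    HasSubgaussianMGF (fun x => f x - ∫ y, f y ∂ν) ((c / 2) ^ 2) ν := by
  have : Nonempty Ω := ν.nonempty_of_neZero
  have hbdd : BddBelow (Set.range f) :=
    ⟨f (Classical.arbitrary Ω) - c, Set.forall_mem_range.2 fun x => by
      linarith [(abs_le.1 (hc x (Classical.arbitrary Ω))).1]⟩
  have hmem : ∀ x, f x ∈ Set.Icc (⨅ y, f y) ((⨅ y, f y) + c) := fun x =>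
    ⟨ciInf_le hbdd x, sub_le_iff_le_add.1 <| le_ciInf fun y => by
      linarith [(abs_le.1 (hc x y)).2]⟩
  simpa using hasSubgaussianMGF_of_mem_Icc hf.aemeasurable (.of_forall hmem)

lemma hasSubgaussianMGF_prod {X Y : Type*} [MeasurableSpace X] [MeasurableSpace Y]
    {μ : Measure X} {ν : Measure Y} [SFinite μ] [SFinite ν]
    {f : X × Y → ℝ} {g : X → ℝ} {c c' : ℝ≥0}
    (hint : ∀ t, Integrable (fun p => Real.exp (t * f p)) (μ.prod ν))
    (hg : HasSubgaussianMGF g c μ)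
    (hf : ∀ x, HasSubgaussianMGF (fun y => f (x, y) - g x) c' ν) :
    HasSubgaussianMGF f (c + c') (μ.prod ν) where
  integrable_exp_mul := hint
  mgf_le t := calc
    mgf f (μ.prod ν) t = ∫ x, ∫ y, Real.exp (t * f (x, y)) ∂ν ∂μ := integral_prod _ (hint t)
    _ = ∫ x, Real.exp (t * g x) * mgf (fun y => f (x, y) - g x) ν t ∂μ := by
      refine integral_congr_ae (.of_forall fun x => ?_)
      simp only [mgf]
      rw [← integral_const_mul]
      simp only [← Real.exp_add, ← mul_add, add_sub_cancel]
    _ ≤ ∫ x, Real.exp (t * g x) * Real.exp (c' * t ^ 2 / 2) ∂μ :=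
      integral_mono_of_nonneg (.of_forall fun x => mul_nonneg (Real.exp_pos _).le mgf_nonneg)
        ((hg.integrable_exp_mul t).mul_const _)
        (.of_forall fun x => mul_le_mul_of_nonneg_left ((hf x).mgf_le t) (Real.exp_pos _).le)
    _ = mgf g μ t * Real.exp (c' * t ^ 2 / 2) := integral_mul_const _ _
    _ ≤ Real.exp (c * t ^ 2 / 2) * Real.exp (c' * t ^ 2 / 2) := by
      gcongr
      exact hg.mgf_le t
    _ = Real.exp ((c + c' : ℝ≥0) * t ^ 2 / 2) := by
      rw [← Real.exp_add]
      push_cast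
      ring_nf

variable {n : ℕ}

lemma abs_sub_le_sum_of_bounded_differences {Z : Fin n → Type*} {f : (∀ i, Z i) → ℝ}
    {c : Fin n → ℝ≥0} (hc : ∀ S i z, |f (Function.update S i z) - f S| ≤ c i) (S T : ∀ i, Z i) :
    |f S - f T| ≤ ∑ i, c i := by
  induction n with
  | zero => simp [Subsingleton.elim S T]
  | succ n ih =>
    have htail : |f (Fin.cons (S 0) (Fin.tail S)) - f (Fin.cons (S 0) (Fin.tail T))| ≤
        (∑ i : Fin n, c i.succ : ℝ≥0) :=
      ih (f := fun R => f (Fin.cons (S 0) R)) (c := fun i => c i.succ)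
        (fun R i z => by simpa only [Fin.cons_update] using hc (Fin.cons (S 0) R) i.succ z) _ _
    have hhead := hc (Fin.cons (T 0) (Fin.tail T)) 0 (S 0)
    rw [Fin.update_cons_zero] at hhead
    rw [Fin.cons_self_tail] at htail hhead
    rw [Fin.sum_univ_succ, NNReal.coe_add, add_comm]
    exact (abs_sub_le _ _ _).trans (add_le_add htail hhead)

lemma exists_forall_abs_le_of_bounded_differences {Z : Fin n → Type*} [Nonempty (∀ i, Z i)]
    {f : (∀ i, Z i) → ℝ} {c : Fin n → ℝ≥0} (hc : ∀ S i z, |f (Function.update S i z) - f S| ≤ c i) :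
    ∃ C, ∀ S, |f S| ≤ C :=
  ⟨∑ i, c i + |f (Classical.arbitrary _)|, fun S => sub_le_iff_le_add.1 <|
    (abs_sub_abs_le_abs_sub _ _).trans (abs_sub_le_sum_of_bounded_differences hc S _)⟩

variable {Z : Fin (n + 1) → Type*} [∀ i, MeasurableSpace (Z i)] (μ : ∀ i, Measure (Z i))
  [∀ i, IsProbabilityMeasure (μ i)]

lemma measurePreserving_finCons :
    MeasurePreserving (fun p : Z 0 × (∀ i : Fin n, Z i.succ) => (Fin.cons p.1 p.2 : ∀ i, Z i))
      ((μ 0).prod (Measure.pi fun i => μ i.succ)) (Measure.pi μ) := by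
  have heq : (fun p : Z 0 × (∀ i : Fin n, Z i.succ) => (Fin.cons p.1 p.2 : ∀ i, Z i)) =
      (MeasurableEquiv.piFinSuccAbove Z 0).symm :=
    funext fun p => (Fin.insertNth_zero p.1 p.2).symm
  rw [heq]
  exact (measurePreserving_piFinSuccAbove μ 0).symm

lemma integral_pi_succ {f : (∀ i, Z i) → ℝ} (hf : Integrable f (Measure.pi μ)) :
    ∫ S, f S ∂(Measure.pi μ) =
      ∫ z, ∫ S, f (Fin.cons z S) ∂(Measure.pi fun i : Fin n => μ i.succ) ∂(μ 0) := by
  have hcons := measurePreserving_finCons μ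
  have hprod := integral_prod (fun p : Z 0 × (∀ i : Fin n, Z i.succ) => f (Fin.cons p.1 p.2))
    (hcons.integrable_comp_of_integrable hf)
  rw [← hprod, ← hcons.map_eq,
    integral_map hcons.aemeasurable (hcons.map_eq ▸ hf.aestronglyMeasurable)]

lemma hasSubgaussianMGF_of_comp_finCons {f : (∀ i, Z i) → ℝ} (hf : Measurable f) {c : ℝ≥0}
    (h : HasSubgaussianMGF (fun p : Z 0 × (∀ i : Fin n, Z i.succ) => f (Fin.cons p.1 p.2)) c
      ((μ 0).prod (Measure.pi fun i => μ i.succ))) :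
    HasSubgaussianMGF f c (Measure.pi μ) := by
  have hcons := measurePreserving_finCons μ
  refine h.congr_identDistrib
    ⟨(hf.comp hcons.measurable).aemeasurable, hf.aemeasurable, ?_⟩
  rw [← hcons.map_eq, Measure.map_map hf hcons.measurable]
  rfl

end BoundedDifferences

/-- **McDiarmid's bounded differences inequality**, in sub-Gaussian form. -/
lemma hasSubgaussianMGF_of_bounded_differences {n : ℕ} {Z : Fin n → Type*}
    [∀ i, MeasurableSpace (Z i)] (μ : ∀ i, Measure (Z i)) [∀ i, IsProbabilityMeasure (μ i)]
    {f : (∀ i, Z i) → ℝ} (hf : Measurable f) {c : Fin n → ℝ≥0}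
    (hc : ∀ S i z, |f (Function.update S i z) - f S| ≤ c i) :
    HasSubgaussianMGF (fun S => f S - ∫ S, f S ∂(Measure.pi μ)) (∑ i, (c i / 2) ^ 2)
      (Measure.pi μ) := by
  induction n with
  | zero =>
    have hconst : ∀ S, f S = f default := fun S => congrArg f (Subsingleton.elim _ _)
    simp only [hconst, integral_const, probReal_univ, one_smul, sub_self, Finset.univ_eq_empty,
      Finset.sum_empty]
    exact HasSubgaussianMGF.fun_zero
  | succ n ih =>
    set ν : Measure (∀ i : Fin n, Z i.succ) := Measure.pi fun i => μ i.succ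
    set m : ℝ := ∫ S, f S ∂(Measure.pi μ)
    set g : Z 0 → ℝ := fun z => ∫ S, f (Fin.cons z S) ∂ν with hg
    have hfc : Measurable fun p : Z 0 × (∀ i : Fin n, Z i.succ) => f (Fin.cons p.1 p.2) :=
      hf.comp (measurePreserving_finCons μ).measurable
    have hfz : ∀ z, Measurable fun S => f (Fin.cons z S) := fun z =>
      hfc.comp measurable_prodMk_left
    have : Nonempty (∀ i, Z i) := (Measure.pi μ).nonempty_of_neZero
    obtain ⟨C, hC⟩ := exists_forall_abs_le_of_bounded_differences hc
    have hint : ∀ z, Integrable (fun S => f (Fin.cons z S)) ν := fun z =>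
      integrable_of_forall_abs_le (hfz z) fun _ => hC _
    have hm : m = ∫ z, g z ∂(μ 0) := integral_pi_succ μ (integrable_of_forall_abs_le hf hC)
    have hgosc : ∀ x y, |g x - g y| ≤ c 0 := fun x y => by
      rw [hg, ← integral_sub (hint x) (hint y)]
      refine abs_integral_le_of_forall_abs_le fun S => ?_
      simpa only [Fin.update_cons_zero] using hc (Fin.cons y S) 0 x
    refine hasSubgaussianMGF_of_comp_finCons μ (hf.sub_const m) ?_
    rw [Fin.sum_univ_succ]
    refine hasSubgaussianMGF_prod (g := fun z => g z - m) (fun t => ?_) ?_ fun z => ?_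
    · refine integrable_exp_of_forall_abs_le ((hfc.sub_const m).const_mul t)
        (C := |t| * (C + |m|)) fun p => ?_
      rw [abs_mul]
      gcongr
      exact (abs_sub _ _).trans (add_le_add_left (hC _) _)
    · rw [hm]
      exact hasSubgaussianMGF_of_forall_abs_sub_le
        hfc.stronglyMeasurable.integral_prod_right.measurable hgosc
    · simp only [sub_sub_sub_cancel_right]
      exact ih (fun i => μ i.succ) (hfz z)
        fun S i w => by simpa only [Fin.cons_update] using hc (Fin.cons z S) i.succ w

lemma measureReal_integral_add_le_of_bounded_differences {n : ℕ} {Z : Fin n → Type*}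
    [∀ i, MeasurableSpace (Z i)] (μ : ∀ i, Measure (Z i)) [∀ i, IsProbabilityMeasure (μ i)]
    {f : (∀ i, Z i) → ℝ} (hf : Measurable f) {c : Fin n → ℝ≥0}
    (hc : ∀ S i z, |f (Function.update S i z) - f S| ≤ c i) {r : ℝ} (hr : 0 ≤ r) :
    (Measure.pi μ).real {S | ∫ S, f S ∂(Measure.pi μ) + r ≤ f S} ≤
      Real.exp (-(2 * r ^ 2 / ∑ i, (c i : ℝ) ^ 2)) := by
  have h := (hasSubgaussianMGF_of_bounded_differences μ hf hc).measure_ge_le hr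
  simp only [le_sub_iff_add_le'] at h
  refine h.trans_eq (congrArg Real.exp ?_)
  push_cast
  simp only [div_pow, ← Finset.sum_div]
  field_simp

/-! ### Rademacher averages -/

section FiniteSup

variable {ι : Type*} [Finite ι] [Nonempty ι]

lemma ciSup_add_le_add_ciSup (f g : ι → ℝ) : ⨆ i, (f i + g i) ≤ (⨆ i, f i) + ⨆ i, g i :=
  ciSup_le fun i => add_le_add (Finite.le_ciSup f i) (Finite.le_ciSup g i)

lemma ciSup_sub_ciSup_le {f g : ι → ℝ} {c : ℝ} (h : ∀ i, f i - g i ≤ c) :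
    (⨆ i, f i) - ⨆ i, g i ≤ c :=
  sub_le_iff_le_add.2 <| ciSup_le fun i =>
    (sub_le_iff_le_add.1 (h i)).trans (add_le_add_right (Finite.le_ciSup g i) c)

lemma abs_ciSup_sub_ciSup_le {f g : ι → ℝ} {c : ℝ} (h : ∀ i, |f i - g i| ≤ c) :
    |(⨆ i, f i) - ⨆ i, g i| ≤ c :=
  abs_sub_le_iff.2 ⟨ciSup_sub_ciSup_le fun i => (abs_sub_le_iff.1 (h i)).1,
    ciSup_sub_ciSup_le fun i => (abs_sub_le_iff.1 (h i)).2⟩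

lemma abs_ciSup_le {f : ι → ℝ} {c : ℝ} (h : ∀ i, |f i| ≤ c) : |⨆ i, f i| ≤ c := by
  simpa using abs_ciSup_sub_ciSup_le (f := f) (g := fun _ => 0) (c := c) (by simpa using h)

end FiniteSup

lemma abs_expect_sub_expect_le {α : Type*} [Fintype α] [Nonempty α] {f g : α → ℝ} {c : ℝ}
    (h : ∀ a, |f a - g a| ≤ c) : |𝔼 a, f a - 𝔼 a, g a| ≤ c := by
  rw [← Finset.expect_sub_distrib]
  exact (Finset.abs_expect_le _ _).trans
    (Finset.expect_le Finset.univ_nonempty fun a _ => h a)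

/-- The sign `±1` encoded by a Boolean; a uniformly random `σ : κ → Bool` then encodes independent
Rademacher signs `sgn (σ k)`. -/
def sgn (b : Bool) : ℝ := if b then 1 else -1

@[simp] lemma sgn_not (b : Bool) : sgn (!b) = -sgn b := by cases b <;> simp [sgn]

@[simp] lemma abs_sgn (b : Bool) : |sgn b| = 1 := by cases b <;> simp [sgn]

@[simp] lemma sgn_mul_self (b : Bool) : sgn b * sgn b = 1 := by cases b <;> simp [sgn]

section Rademacher

variable {ι κ : Type*} [Fintype κ] [DecidableEq κ]

/-- The Rademacher complexity of the family of vectors `u i`: the expected supremum of their inner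
products with a random sign vector. It is not normalized by the number of coordinates. -/
noncomputable def rademacherSup (u : ι → κ → ℝ) : ℝ :=
  𝔼 σ : κ → Bool, ⨆ i, ∑ k, sgn (σ k) * u i k

lemma expect_update_not (k : κ) (F : (κ → Bool) → ℝ) :
    𝔼 σ : κ → Bool, F (Function.update σ k (!σ k)) = 𝔼 σ, F σ :=
  have hinv : Function.Involutive fun σ : κ → Bool => Function.update σ k (!σ k) := fun σ => by
    simp
  Fintype.expect_equiv hinv.toPerm _ _ fun _ => rfl

lemma expect_not (F : (κ → Bool) → ℝ) : 𝔼 σ : κ → Bool, F (fun k => !σ k) = 𝔼 σ, F σ :=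
  Fintype.expect_equiv (Equiv.piCongrRight fun _ => Equiv.boolNot) _ _ fun _ => rfl

lemma rademacherSup_const_mul {a : ℝ} (ha : 0 ≤ a) (u : ι → κ → ℝ) :
    rademacherSup (fun i k => a * u i k) = a * rademacherSup u := by
  simp only [rademacherSup, Finset.mul_expect, Real.mul_iSup_of_nonneg ha, Finset.mul_sum,
    mul_left_comm]

lemma rademacherSup_add_self (u : ι → κ → ℝ) (k : κ) :
    rademacherSup u + rademacherSup u = 𝔼 σ : κ → Bool,
      ((⨆ i, (∑ l ∈ Finset.univ.erase k, sgn (σ l) * u i l + sgn (σ k) * u i k)) +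
        ⨆ i, (∑ l ∈ Finset.univ.erase k, sgn (σ l) * u i l - sgn (σ k) * u i k)) := by
  rw [Finset.expect_add_distrib]
  congr 1
  · simp only [Finset.sum_erase_add _ _ (Finset.mem_univ k), rademacherSup]
  · rw [rademacherSup, ← expect_update_not k]
    refine Finset.expect_congr rfl fun σ _ => iSup_congr fun i => ?_
    rw [← Finset.sum_erase_add _ _ (Finset.mem_univ k), Function.update_self, sgn_not, neg_mul,
      ← sub_eq_add_neg]
    congr 1
    refine Finset.sum_congr rfl fun l hl => ?_
    rw [Function.update_of_ne (Finset.ne_of_mem_erase hl)]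

variable [Finite ι] [Nonempty ι]

lemma rademacherSup_add_le (u w : ι → κ → ℝ) :
    rademacherSup (fun i k => u i k + w i k) ≤ rademacherSup u + rademacherSup w := by
  rw [rademacherSup, rademacherSup, rademacherSup, ← Finset.expect_add_distrib]
  refine Finset.expect_le_expect fun σ _ => ?_
  simp only [mul_add, Finset.sum_add_distrib]
  exact ciSup_add_le_add_ciSup _ _

/-! ### Contraction -/

lemma ciSup_add_ciSup_sub_le {g a b : ι → ℝ} (h : ∀ i j, |a i - a j| ≤ |b i - b j|) :
    (⨆ i, (g i + a i)) + (⨆ i, (g i - a i)) ≤ (⨆ i, (g i + b i)) + ⨆ i, (g i - b i) := by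
  obtain ⟨i, hi⟩ := exists_eq_ciSup_of_finite (f := fun i => g i + a i)
  obtain ⟨j, hj⟩ := exists_eq_ciSup_of_finite (f := fun i => g i - a i)
  have hab := (le_abs_self _).trans (h i j)
  have hadd := Finite.le_ciSup fun i => g i + b i
  have hsub := Finite.le_ciSup fun i => g i - b i
  rw [← hi, ← hj]
  rcases abs_cases (b i - b j) with hb | hb <;> linarith [hadd i, hsub j, hadd j, hsub i]

lemma rademacherSup_le_of_contraction_at {u v : ι → κ → ℝ} (k : κ)
    (hoff : ∀ i, ∀ l ≠ k, v i l = u i l) (hk : ∀ i j, |v i k - v j k| ≤ |u i k - u j k|) :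
    rademacherSup v ≤ rademacherSup u := by
  suffices rademacherSup v + rademacherSup v ≤ rademacherSup u + rademacherSup u by linarith
  rw [rademacherSup_add_self v k, rademacherSup_add_self u k]
  refine Finset.expect_le_expect fun σ _ => ?_
  have hrest : ∀ i, ∑ l ∈ Finset.univ.erase k, sgn (σ l) * v i l =
      ∑ l ∈ Finset.univ.erase k, sgn (σ l) * u i l := fun i =>
    Finset.sum_congr rfl fun l hl => by rw [hoff i l (Finset.ne_of_mem_erase hl)]
  simp only [hrest]
  refine ciSup_add_ciSup_sub_le fun i j => ?_
  rw [← mul_sub, ← mul_sub, abs_mul, abs_mul, abs_sgn, one_mul, one_mul]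
  exact hk i j

/-- **Talagrand's contraction principle**. -/
lemma rademacherSup_le_of_contraction {u v : ι → κ → ℝ}
    (h : ∀ i j k, |v i k - v j k| ≤ |u i k - u j k|) : rademacherSup v ≤ rademacherSup u := by
  have key : ∀ s : Finset κ,
      rademacherSup (fun i k => if k ∈ s then v i k else u i k) ≤ rademacherSup u := by
    intro s
    induction s using Finset.induction_on with
    | empty => simp
    | insert k s hk ih =>
      refine (rademacherSup_le_of_contraction_at k (fun i l hl => ?_) fun i j => ?_).trans ih
      · simp [hl]
      · simpa [hk] using h i j k
  simpa using key Finset.univ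

end Rademacher

/-! ### Moments of Rademacher sums -/

section Moments

variable {κ : Type*} [Fintype κ] [DecidableEq κ]

lemma expect_eq_zero_of_update_not {F : (κ → Bool) → ℝ} (k : κ)
    (hF : ∀ σ, F (Function.update σ k (!σ k)) = -F σ) : 𝔼 σ, F σ = 0 := by
  have h := expect_update_not k F
  simp only [hF, Finset.expect_neg_distrib] at h
  linarith

lemma expect_sgn (k : κ) : 𝔼 σ : κ → Bool, sgn (σ k) = 0 :=
  expect_eq_zero_of_update_not k fun σ => by simp

lemma expect_sgn_mul_sgn {k l : κ} (hkl : k ≠ l) :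
    𝔼 σ : κ → Bool, sgn (σ k) * sgn (σ l) = 0 :=
  expect_eq_zero_of_update_not k fun σ => by simp [Function.update_of_ne hkl.symm]

lemma expect_sum_sgn_mul (a : κ → ℝ) : 𝔼 σ : κ → Bool, ∑ k, sgn (σ k) * a k = 0 := by
  simp only [Finset.expect_sum_comm, ← Finset.expect_mul, expect_sgn, zero_mul,
    Finset.sum_const_zero]

lemma expect_sum_sgn_mul_sq (a : κ → ℝ) :
    𝔼 σ : κ → Bool, (∑ k, sgn (σ k) * a k) ^ 2 = ∑ k, a k ^ 2 := by
  have hcross : ∀ k l, 𝔼 σ : κ → Bool, sgn (σ k) * sgn (σ l) = if k = l then 1 else 0 := by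
    intro k l
    split_ifs with hkl
    · subst hkl
      simp only [sgn_mul_self, Fintype.expect_const]
    · exact expect_sgn_mul_sgn hkl
  have hmul : ∀ (σ : κ → Bool) k l, sgn (σ k) * a k * (sgn (σ l) * a l) =
      sgn (σ k) * sgn (σ l) * (a k * a l) := fun σ k l => mul_mul_mul_comm _ _ _ _
  simp only [sq, Finset.sum_mul_sum, Finset.expect_sum_comm, hmul, ← Finset.expect_mul, hcross,
    ite_mul, one_mul, zero_mul, Finset.sum_ite_eq, Finset.mem_univ, if_true]

lemma expect_abs_sum_sgn_mul_le (a : κ → ℝ) :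
    𝔼 σ : κ → Bool, |∑ k, sgn (σ k) * a k| ≤ √(∑ k, a k ^ 2) := by
  refine Real.le_sqrt_of_sq_le ?_
  have h := Finset.expect_mul_sq_le_sq_mul_sq Finset.univ
    (fun σ : κ → Bool => |∑ k, sgn (σ k) * a k|) 1
  simpa only [Pi.one_apply, mul_one, one_pow, sq_abs, expect_sum_sgn_mul_sq,
    Fintype.expect_const] using h

lemma rademacherSup_neg_const_le {ι : Type*} [Nonempty ι] {c : ι → ℝ} {C : ℝ}
    (hc : ∀ i, c i ∈ Set.Icc 0 C) :
    rademacherSup (fun i (_ : κ) => -c i) ≤ C * √(Fintype.card κ) / 2 := by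
  have hC : 0 ≤ C := (hc (Classical.arbitrary ι)).1.trans (hc _).2
  set s : (κ → Bool) → ℝ := fun σ => ∑ k, sgn (σ k) with hs
  have hpt : ∀ σ i, ∑ k, sgn (σ k) * -c i ≤ C / 2 * (|s σ| - s σ) := by
    intro σ i
    rw [← Finset.sum_mul]
    obtain ⟨h0, hC⟩ := hc i
    rcases abs_cases (s σ) with h | h <;> nlinarith
  have habs : 𝔼 σ, |s σ| ≤ √(Fintype.card κ) := by
    simpa [hs] using expect_abs_sum_sgn_mul_le fun _ : κ => (1 : ℝ)
  have hzero : 𝔼 σ, s σ = 0 := by simpa [hs] using expect_sum_sgn_mul fun _ : κ => (1 : ℝ)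
  calc rademacherSup (fun i (_ : κ) => -c i) ≤ 𝔼 σ, C / 2 * (|s σ| - s σ) :=
        Finset.expect_le_expect fun σ _ => ciSup_le (hpt σ)
    _ = C / 2 * 𝔼 σ, |s σ| := by
        rw [← Finset.mul_expect, Finset.expect_sub_distrib, hzero, sub_zero]
    _ ≤ C / 2 * √(Fintype.card κ) := by gcongr
    _ = C * √(Fintype.card κ) / 2 := by ring

lemma expect_exp_sum_sgn_mul_le (a : κ → ℝ) :
    𝔼 σ : κ → Bool, Real.exp (∑ k, sgn (σ k) * a k) ≤ Real.exp ((∑ k, a k ^ 2) / 2) := by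
  have hcosh : 𝔼 σ : κ → Bool, Real.exp (∑ k, sgn (σ k) * a k) = ∏ k, Real.cosh (a k) := by
    have hprod : ∑ σ : κ → Bool, ∏ k, Real.exp (sgn (σ k) * a k) =
        ∏ k, ∑ b : Bool, Real.exp (sgn b * a k) := by
      rw [Finset.prod_univ_sum, Fintype.piFinset_univ]
    simp only [Fintype.expect_eq_sum_div_card, Real.exp_sum, hprod, Fintype.sum_bool,
      Real.cosh_eq, Finset.prod_div_distrib]
    simp [sgn]
  rw [hcosh, Finset.sum_div, Real.exp_sum]
  exact Finset.prod_le_prod (fun k _ => (Real.cosh_pos _).le) fun k _ => Real.cosh_le_exp_half_sq _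

end Moments

lemma expect_le_of_expect_exp_le {α : Type*} [Fintype α] [Nonempty α] {F : α → ℝ} {a : ℝ}
    (h : 𝔼 x, Real.exp (F x) ≤ Real.exp a) : 𝔼 x, F x ≤ a := by
  have hle : 𝔼 x, (F x + (1 - a)) ≤ 𝔼 x, Real.exp (-a) * Real.exp (F x) :=
    Finset.expect_le_expect fun x _ => by
      rw [← Real.exp_add]
      linarith [Real.add_one_le_exp (-a + F x)]
  rw [Finset.expect_add_distrib, Fintype.expect_const, ← Finset.mul_expect] at hle
  have hone : Real.exp (-a) * 𝔼 x, Real.exp (F x) ≤ 1 := by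
    calc _ ≤ Real.exp (-a) * Real.exp a := by gcongr
      _ = 1 := by rw [← Real.exp_add, neg_add_cancel, Real.exp_zero]
  linarith

/-! ### Symmetrization -/

section SupSum

variable {Z ι κ : Type*} [Fintype κ] {f : ι → κ → Z → ℝ}

lemma measurable_ciSup_sum [MeasurableSpace Z] [Countable ι] (hf : ∀ i k, Measurable (f i k)) :
    Measurable fun S : κ → Z => ⨆ i, ∑ k, f i k (S k) :=
  .iSup fun i => Finset.measurable_sum _ fun k _ => (hf i k).comp (measurable_pi_apply k)

variable [Finite ι] [Nonempty ι] {c : ℝ}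

lemma abs_ciSup_sum_le (hf : ∀ i k z, |f i k z| ≤ c) (S : κ → Z) :
    |⨆ i, ∑ k, f i k (S k)| ≤ Fintype.card κ * c :=
  abs_ciSup_le fun i => (Finset.abs_sum_le_sum_abs _ _).trans <|
    (Finset.sum_le_card_nsmul _ _ c fun k _ => hf i k _).trans_eq (nsmul_eq_mul _ _)

lemma integrable_ciSup_sum [MeasurableSpace Z] {ν : Measure (κ → Z)} [IsFiniteMeasure ν]
    (hm : ∀ i k, Measurable (f i k)) (hf : ∀ i k z, |f i k z| ≤ c) :
    Integrable (fun S : κ → Z => ⨆ i, ∑ k, f i k (S k)) ν :=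
  integrable_of_forall_abs_le (measurable_ciSup_sum hm) (abs_ciSup_sum_le hf)

lemma abs_ciSup_sum_update_sub_le [DecidableEq κ] (hf : ∀ i k z w, |f i k z - f i k w| ≤ c)
    (S : κ → Z) (k : κ) (z : Z) :
    |(⨆ i, ∑ l, f i l (Function.update S k z l)) - ⨆ i, ∑ l, f i l (S l)| ≤ c := by
  refine abs_ciSup_sub_ciSup_le fun i => ?_
  rw [← Finset.sum_sub_distrib, Finset.sum_eq_single k]
  · rw [Function.update_self]
    exact hf i k z (S k)
  · intro l _ hl
    rw [Function.update_of_ne hl, sub_self]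
  · exact fun hk => absurd (Finset.mem_univ k) hk

lemma abs_rademacherSup_update_sub_le [DecidableEq κ] {ℓ : ι → Z → ℝ}
    (hℓ : ∀ i z w, |ℓ i z - ℓ i w| ≤ c) (S : κ → Z) (k : κ) (z : Z) :
    |rademacherSup (fun i l => ℓ i (Function.update S k z l)) -
      rademacherSup fun i l => ℓ i (S l)| ≤ c :=
  abs_expect_sub_expect_le fun σ =>
    abs_ciSup_sum_update_sub_le (f := fun i k z => sgn (σ k) * ℓ i z) (fun i k z w => by
      rw [← mul_sub, abs_mul, abs_sgn, one_mul]
      exact hℓ i z w) S k z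

end SupSum

lemma integral_comp_of_measurePreserving {X Y : Type*} [MeasurableSpace X] [MeasurableSpace Y]
    {μ : Measure X} {ν : Measure Y} {g : X → Y} (hg : MeasurePreserving g μ ν) {f : Y → ℝ}
    (hf : AEStronglyMeasurable f ν) : ∫ x, f (g x) ∂μ = ∫ y, f y ∂ν := by
  rw [← integral_map hg.aemeasurable (hg.map_eq ▸ hf), hg.map_eq]

lemma abs_sub_le_one_of_mem_Icc {x y : ℝ} (hx : x ∈ Set.Icc (0 : ℝ) 1)
    (hy : y ∈ Set.Icc (0 : ℝ) 1) : |x - y| ≤ 1 :=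
  abs_sub_le_of_nonneg_of_le hx.1 hx.2 hy.1 hy.2

section Symmetrization

variable {Z : Type*} [MeasurableSpace Z] (μ : Measure Z) [IsProbabilityMeasure μ]
  {ι κ : Type*} [Fintype κ] {ℓ : ι → Z → ℝ}

/-- The one-sided uniform deviation of the family of losses `ℓ` on the sample `S`: the largest
excess of the expected over the empirical loss. Both are summed, not averaged, over the sample. -/
noncomputable def uniformDeviation (ℓ : ι → Z → ℝ) (S : κ → Z) : ℝ :=
  ⨆ i, ∑ k, (∫ z, ℓ i z ∂μ - ℓ i (S k))

lemma measurePreserving_ite_swap (σ : κ → Bool) :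
    MeasurePreserving (fun (T : κ → Z × Z) k => if σ k then T k else (T k).swap)
      (Measure.pi fun _ => μ.prod μ) (Measure.pi fun _ => μ.prod μ) := by
  refine measurePreserving_pi (f := fun k p => if σ k then p else p.swap)
    (fun _ => μ.prod μ) (fun _ => μ.prod μ) fun k => ?_
  cases σ k
  · simpa only [Bool.false_eq_true, if_false] using Measure.measurePreserving_swap
  · simpa only [if_true] using! MeasurePreserving.id (μ.prod μ)

lemma integral_mem_Icc {f : Z → ℝ} (hf : Measurable f) (h : ∀ z, f z ∈ Set.Icc (0 : ℝ) 1) :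
    ∫ z, f z ∂μ ∈ Set.Icc (0 : ℝ) 1 := by
  refine ⟨integral_nonneg fun z => (h z).1, ?_⟩
  have hint : Integrable f μ := .of_mem_Icc 0 1 hf.aemeasurable (.of_forall h)
  simpa using integral_mono hint (integrable_const 1) fun z => (h z).2

variable [Finite ι] [Nonempty ι] (hm : ∀ i, Measurable (ℓ i))
  (hℓ : ∀ i z, ℓ i z ∈ Set.Icc (0 : ℝ) 1)

include hm hℓ

lemma integrable_ciSup_sum_sgn_mul (σ : κ → Bool) :
    Integrable (fun S : κ → Z => ⨆ i, ∑ k, sgn (σ k) * ℓ i (S k)) (Measure.pi fun _ => μ) :=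
  integrable_ciSup_sum (f := fun i k z => sgn (σ k) * ℓ i z) (c := 1)
    (fun i k => (hm i).const_mul _) fun i k z => by
      rw [abs_mul, abs_sgn, one_mul, abs_of_nonneg (hℓ i z).1]
      exact (hℓ i z).2

lemma integrable_ciSup_sum_fst_sub_snd :
    Integrable (fun T : κ → Z × Z => ⨆ i, ∑ k, (ℓ i (T k).1 - ℓ i (T k).2))
      (Measure.pi fun _ => μ.prod μ) :=
  integrable_ciSup_sum (f := fun i (_ : κ) (p : Z × Z) => ℓ i p.1 - ℓ i p.2) (c := 1)
    (fun i _ => ((hm i).comp measurable_fst).sub ((hm i).comp measurable_snd))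
    fun i _ p => abs_sub_le_one_of_mem_Icc (hℓ i p.1) (hℓ i p.2)

lemma integral_ciSup_sum_fst_sub_snd_le (σ : κ → Bool) :
    ∫ T, (⨆ i, ∑ k, (ℓ i (T k).1 - ℓ i (T k).2)) ∂(Measure.pi fun _ : κ => μ.prod μ) ≤
      ∫ S, (⨆ i, ∑ k, sgn (σ k) * ℓ i (S k)) ∂(Measure.pi fun _ => μ) +
        ∫ S, (⨆ i, ∑ k, sgn (!σ k) * ℓ i (S k)) ∂(Measure.pi fun _ => μ) := by
  set ρ : Measure (κ → Z × Z) := Measure.pi fun _ => μ.prod μ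
  set A : (κ → Bool) → (κ → Z) → ℝ := fun τ S => ⨆ i, ∑ k, sgn (τ k) * ℓ i (S k)
  set G : (κ → Z × Z) → ℝ := fun T => ⨆ i, ∑ k, (ℓ i (T k).1 - ℓ i (T k).2)
  have hswap := measurePreserving_ite_swap μ σ
  have hfst : MeasurePreserving (fun T k => (T k).1) ρ (Measure.pi fun _ => μ) :=
    measurePreserving_pi _ _ fun _ => measurePreserving_fst
  have hsnd : MeasurePreserving (fun T k => (T k).2) ρ (Measure.pi fun _ => μ) :=
    measurePreserving_pi _ _ fun _ => measurePreserving_snd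
  have hAint : ∀ τ, Integrable (A τ) (Measure.pi fun _ => μ) :=
    integrable_ciSup_sum_sgn_mul μ hm hℓ
  have hGint : Integrable G ρ := integrable_ciSup_sum_fst_sub_snd μ hm hℓ
  have hA₁ : Integrable (fun T : κ → Z × Z => A σ fun k => (T k).1) ρ :=
    hfst.integrable_comp_of_integrable (hAint σ)
  have hA₂ : Integrable (fun T : κ → Z × Z => A (fun k => !σ k) fun k => (T k).2) ρ :=
    hsnd.integrable_comp_of_integrable (hAint _)
  have hpt : ∀ T : κ → Z × Z, G (fun k => if σ k then T k else (T k).swap) ≤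
      A σ (fun k => (T k).1) + A (fun k => !σ k) fun k => (T k).2 := fun T => by
    refine le_of_eq_of_le (iSup_congr fun i => ?_) (ciSup_add_le_add_ciSup _ _)
    rw [← Finset.sum_add_distrib]
    refine Finset.sum_congr rfl fun k _ => ?_
    cases hσ : σ k <;> simp [sgn, hσ] <;> ring
  calc ∫ T, G T ∂ρ = ∫ T, G (fun k => if σ k then T k else (T k).swap) ∂ρ :=
        (integral_comp_of_measurePreserving hswap hGint.aestronglyMeasurable).symm
    _ ≤ ∫ T, (A σ (fun k => (T k).1) + A (fun k => !σ k) fun k => (T k).2) ∂ρ :=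
        integral_mono (hswap.integrable_comp_of_integrable hGint) (hA₁.add hA₂) hpt
    _ = _ := by
        rw [integral_add hA₁ hA₂,
          integral_comp_of_measurePreserving hfst (hAint σ).aestronglyMeasurable,
          integral_comp_of_measurePreserving hsnd (hAint _).aestronglyMeasurable]

lemma integral_rademacherSup [DecidableEq κ] :
    ∫ S, rademacherSup (fun i (k : κ) => ℓ i (S k)) ∂(Measure.pi fun _ => μ) =
      𝔼 σ : κ → Bool, ∫ S, (⨆ i, ∑ k, sgn (σ k) * ℓ i (S k)) ∂(Measure.pi fun _ => μ) := by
  simp only [rademacherSup, Fintype.expect_eq_sum_div_card]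
  rw [integral_div, integral_finsetSum _ fun σ _ => integrable_ciSup_sum_sgn_mul μ hm hℓ σ]

lemma integral_ciSup_sum_fst_sub_snd_le_rademacherSup [DecidableEq κ] :
    ∫ T, (⨆ i, ∑ k, (ℓ i (T k).1 - ℓ i (T k).2)) ∂(Measure.pi fun _ : κ => μ.prod μ) ≤
      2 * ∫ S, rademacherSup (fun i (k : κ) => ℓ i (S k)) ∂(Measure.pi fun _ => μ) := by
  have h := Finset.expect_le_expect fun (σ : κ → Bool) (_ : σ ∈ Finset.univ) =>
    integral_ciSup_sum_fst_sub_snd_le μ hm hℓ σ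
  rwa [Fintype.expect_const, Finset.expect_add_distrib,
    expect_not fun σ => ∫ S, (⨆ i, ∑ k, sgn (σ k) * ℓ i (S k)) ∂(Measure.pi fun _ => μ),
    ← integral_rademacherSup μ hm hℓ, ← two_mul] at h

lemma integrable_uniformDeviation :
    Integrable (uniformDeviation μ ℓ : (κ → Z) → ℝ) (Measure.pi fun _ => μ) :=
  integrable_ciSup_sum (f := fun i _ w => ∫ z, ℓ i z ∂μ - ℓ i w) (c := 1)
    (fun i _ => (hm i).const_sub _)
    fun i _ z => abs_sub_le_one_of_mem_Icc (integral_mem_Icc μ (hm i) (hℓ i)) (hℓ i z)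

lemma uniformDeviation_le_integral (S : κ → Z) :
    uniformDeviation μ ℓ S ≤
      ∫ S', (⨆ i, ∑ k, (ℓ i (S' k) - ℓ i (S k))) ∂(Measure.pi fun _ => μ) := by
  refine ciSup_le fun i => ?_
  have hint : ∀ k, Integrable (fun S' : κ → Z => ℓ i (S' k)) (Measure.pi fun _ => μ) := fun k =>
    integrable_comp_eval (.of_mem_Icc 0 1 (hm i).aemeasurable (.of_forall (hℓ i)))
  have hdiff : ∀ k, Integrable (fun S' : κ → Z => ℓ i (S' k) - ℓ i (S k)) (Measure.pi fun _ => μ) :=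
    fun k => (hint k).sub (integrable_const _)
  have hsum : ∑ k, (∫ z, ℓ i z ∂μ - ℓ i (S k)) =
      ∫ S', ∑ k, (ℓ i (S' k) - ℓ i (S k)) ∂(Measure.pi fun _ => μ) := by
    rw [integral_finsetSum _ fun k _ => hdiff k]
    refine Finset.sum_congr rfl fun k _ => ?_
    rw [integral_sub (hint k) (integrable_const _), integral_const, probReal_univ, one_smul,
      integral_comp_eval (hm i).aestronglyMeasurable]
  rw [hsum]
  refine integral_mono (integrable_finsetSum _ fun k _ => hdiff k) ?_
    fun S' => Finite.le_ciSup (fun i => ∑ k, (ℓ i (S' k) - ℓ i (S k))) i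
  exact integrable_ciSup_sum (f := fun i k w => ℓ i w - ℓ i (S k)) (c := 1)
    (fun i k => (hm i).sub_const _) fun i k z => abs_sub_le_one_of_mem_Icc (hℓ i z) (hℓ i _)

lemma integral_uniformDeviation_le [DecidableEq κ] :
    ∫ S : κ → Z, uniformDeviation μ ℓ S ∂(Measure.pi fun _ => μ) ≤
      2 * ∫ S, rademacherSup (fun i (k : κ) => ℓ i (S k)) ∂(Measure.pi fun _ => μ) := by
  set ν : Measure (κ → Z) := Measure.pi fun _ => μ
  have hpair : MeasurePreserving (MeasurableEquiv.arrowProdEquivProdArrow Z Z κ).symm (ν.prod ν)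
      (Measure.pi fun _ => μ.prod μ) :=
    (measurePreserving_arrowProdEquivProdArrow Z Z κ (fun _ => μ) fun _ => μ).symm
  have hint : Integrable
      (fun p : (κ → Z) × (κ → Z) => ⨆ i, ∑ k, (ℓ i (p.1 k) - ℓ i (p.2 k))) (ν.prod ν) :=
    hpair.integrable_comp_of_integrable (integrable_ciSup_sum_fst_sub_snd μ hm hℓ)
  calc ∫ S, uniformDeviation μ ℓ S ∂ν
      ≤ ∫ S, ∫ S', (⨆ i, ∑ k, (ℓ i (S' k) - ℓ i (S k))) ∂ν ∂ν :=
        integral_mono (integrable_uniformDeviation μ hm hℓ) hint.integral_prod_right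
          (uniformDeviation_le_integral μ hm hℓ)
    _ = ∫ p, (⨆ i, ∑ k, (ℓ i (p.1 k) - ℓ i (p.2 k))) ∂(ν.prod ν) :=
        (integral_prod_symm _ hint).symm
    _ = ∫ T, (⨆ i, ∑ k, (ℓ i (T k).1 - ℓ i (T k).2)) ∂(Measure.pi fun _ => μ.prod μ) :=
        hpair.integral_comp' fun T => ⨆ i, ∑ k, (ℓ i (T k).1 - ℓ i (T k).2)
    _ ≤ _ := integral_ciSup_sum_fst_sub_snd_le_rademacherSup μ hm hℓ

end Symmetrization

/-! ### Uniform convergence -/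

section UniformConvergence

variable {Z : Type*} [MeasurableSpace Z] (μ : Measure Z) {n : ℕ}

section Finite

variable {ι : Type*} [Finite ι] {ℓ : ι → Z → ℝ}

lemma measurable_rademacherSup (hm : ∀ i, Measurable (ℓ i)) :
    Measurable fun S : Fin n → Z => rademacherSup fun i k => ℓ i (S k) := by
  simp only [rademacherSup, Fintype.expect_eq_sum_div_card]
  exact (Finset.measurable_sum _ fun σ _ => measurable_ciSup_sum
    (f := fun i k z => sgn (σ k) * ℓ i z) fun i k => (hm i).const_mul _).div_const _

variable [Nonempty ι]

lemma integrable_rademacherSup [IsProbabilityMeasure μ] (hm : ∀ i, Measurable (ℓ i))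
    (hℓ : ∀ i z, ℓ i z ∈ Set.Icc (0 : ℝ) 1) :
    Integrable (fun S : Fin n → Z => rademacherSup fun i k => ℓ i (S k))
      (Measure.pi fun _ => μ) := by
  have : Nonempty (Fin n → Z) := (Measure.pi fun _ => μ).nonempty_of_neZero
  obtain ⟨C, hC⟩ := exists_forall_abs_le_of_bounded_differences
    (f := fun S : Fin n → Z => rademacherSup fun i k => ℓ i (S k)) (c := fun _ => 1)
    (abs_rademacherSup_update_sub_le fun i z w => abs_sub_le_one_of_mem_Icc (hℓ i z) (hℓ i w))
  exact integrable_of_forall_abs_le (measurable_rademacherSup hm) hC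

lemma abs_uniformDeviation_update_sub_le (hℓ : ∀ i z, ℓ i z ∈ Set.Icc (0 : ℝ) 1)
    (S : Fin n → Z) (k : Fin n) (z : Z) :
    |uniformDeviation μ ℓ (Function.update S k z) - uniformDeviation μ ℓ S| ≤ 1 :=
  abs_ciSup_sum_update_sub_le (f := fun i (_ : Fin n) z => ∫ w, ℓ i w ∂μ - ℓ i z)
    (fun i _ z w => by
      rw [sub_sub_sub_cancel_left]
      exact abs_sub_le_one_of_mem_Icc (hℓ i w) (hℓ i z)) S k z

variable [IsProbabilityMeasure μ]

/- The mean of `uniformDeviation μ ℓ - 2 * rademacherSup` is nonpositive by symmetrization, so the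
bounded differences inequality is needed only once, with all constants equal to `3`. -/
lemma measureReal_le_uniformDeviation_sub_le (hm : ∀ i, Measurable (ℓ i))
    (hℓ : ∀ i z, ℓ i z ∈ Set.Icc (0 : ℝ) 1) {r : ℝ} (hr : 0 ≤ r) :
    (Measure.pi fun _ => μ).real {S : Fin n → Z |
      r ≤ uniformDeviation μ ℓ S - 2 * rademacherSup fun i k => ℓ i (S k)} ≤
      Real.exp (-(2 * r ^ 2 / (9 * n))) := by
  set ν : Measure (Fin n → Z) := Measure.pi fun _ => μ
  set f : (Fin n → Z) → ℝ := fun S =>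
    uniformDeviation μ ℓ S - 2 * rademacherSup fun i k => ℓ i (S k) with hf
  have hfm : Measurable f := (measurable_ciSup_sum (f := fun i _ z => ∫ w, ℓ i w ∂μ - ℓ i z)
    fun i _ => (hm i).const_sub _).sub ((measurable_rademacherSup hm).const_mul 2)
  have hmean : ∫ S, f S ∂ν ≤ 0 := by
    rw [hf, integral_sub (integrable_uniformDeviation μ hm hℓ)
      ((integrable_rademacherSup μ hm hℓ).const_mul 2), integral_const_mul]
    exact sub_nonpos.2 (integral_uniformDeviation_le μ hm hℓ)
  have hdiff : ∀ S k z, |f (Function.update S k z) - f S| ≤ (3 : ℝ≥0) := fun S k z => by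
    have hU := abs_le.1 (abs_uniformDeviation_update_sub_le μ hℓ S k z)
    have hR := abs_le.1 (abs_rademacherSup_update_sub_le (κ := Fin n)
      (fun i z w => abs_sub_le_one_of_mem_Icc (hℓ i z) (hℓ i w)) S k z)
    rw [NNReal.coe_ofNat, hf, abs_le]
    constructor <;> linarith
  have h := measureReal_integral_add_le_of_bounded_differences (fun _ => μ) hfm hdiff hr
  refine (measureReal_mono fun S (hS : r ≤ f S) => ?_).trans (h.trans_eq ?_)
  · exact (add_le_of_nonpos_left hmean).trans hS
  · simp only [NNReal.coe_ofNat, Finset.sum_const, Finset.card_univ, Fintype.card_fin,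
      nsmul_eq_mul]
    ring_nf

lemma le_measureReal_forall_integral_le_rademacherSup (hm : ∀ i, Measurable (ℓ i))
    (hℓ : ∀ i z, ℓ i z ∈ Set.Icc (0 : ℝ) 1) (hn : 0 < n) {δ : ℝ} (hδ₀ : 0 < δ) (hδ₁ : δ ≤ 1) :
    1 - δ ≤ (Measure.pi fun _ => μ).real {S : Fin n → Z | ∀ i, n * ∫ z, ℓ i z ∂μ ≤
      ∑ k, ℓ i (S k) + 2 * rademacherSup (fun i k => ℓ i (S k)) +
        3 * √(n * Real.log (1 / δ) / 2)} := by
  set r := 3 * √(n * Real.log (1 / δ) / 2) with hr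
  have hlog : 0 ≤ Real.log (1 / δ) := Real.log_nonneg (by rwa [le_div_iff₀ hδ₀, one_mul])
  have hexp : Real.exp (-(2 * r ^ 2 / (9 * n))) = δ := by
    have hr2 : 2 * r ^ 2 / (9 * n) = -Real.log δ := by
      rw [hr, mul_pow, Real.sq_sqrt (by positivity), one_div, Real.log_inv]
      field_simp
      ring
    rw [hr2, neg_neg, Real.exp_log hδ₀]
  set B : Set (Fin n → Z) :=
    {S | r ≤ uniformDeviation μ ℓ S - 2 * rademacherSup fun i k => ℓ i (S k)}
  have hB : (Measure.pi fun _ => μ).real B ≤ δ :=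
    (measureReal_le_uniformDeviation_sub_le μ hm hℓ (by positivity)).trans_eq hexp
  have hunion := measureReal_union_le (μ := Measure.pi fun _ => μ) B Bᶜ
  rw [Set.union_compl_self, probReal_univ] at hunion
  refine (by linarith : 1 - δ ≤ (Measure.pi fun _ => μ).real Bᶜ).trans
    (measureReal_mono fun S hS i => ?_)
  have hlt : uniformDeviation μ ℓ S - 2 * rademacherSup (fun i k => ℓ i (S k)) < r := not_le.1 hS
  have hi := Finite.le_ciSup (fun i => ∑ k, (∫ z, ℓ i z ∂μ - ℓ i (S k))) i
  rw [← uniformDeviation] at hi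
  simp only [Finset.sum_sub_distrib, Finset.sum_const, Finset.card_univ, Fintype.card_fin,
    nsmul_eq_mul] at hi
  linarith

end Finite

lemma measurableSet_integral_le_add {ℓ : Z → ℝ} (hm : Measurable ℓ) {b : (Fin n → Z) → ℝ}
    (hb : Measurable b) (r : ℝ) :
    MeasurableSet {S : Fin n → Z | n * ∫ z, ℓ z ∂μ ≤ ∑ k, ℓ (S k) + 2 * b S + r} :=
  measurableSet_le measurable_const (by fun_prop)

variable [IsProbabilityMeasure μ]

lemma le_measureReal_forall_seq_integral_le {ℓ : ℕ → Z → ℝ} (hm : ∀ i, Measurable (ℓ i))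
    (hℓ : ∀ i z, ℓ i z ∈ Set.Icc (0 : ℝ) 1) {b : (Fin n → Z) → ℝ} (hb : Measurable b)
    (hrad : ∀ m S, rademacherSup (fun (i : Fin (m + 1)) k => ℓ i (S k)) ≤ b S)
    (hn : 0 < n) {δ : ℝ} (hδ₀ : 0 < δ) (hδ₁ : δ ≤ 1) :
    1 - δ ≤ (Measure.pi fun _ => μ).real {S : Fin n → Z | ∀ i, n * ∫ z, ℓ i z ∂μ ≤
      ∑ k, ℓ i (S k) + 2 * b S + 3 * √(n * Real.log (1 / δ) / 2)} := by
  set r := 3 * √(n * Real.log (1 / δ) / 2)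
  set A : ℕ → Set (Fin n → Z) := fun m =>
    {S | ∀ i : Fin (m + 1), n * ∫ z, ℓ i z ∂μ ≤ ∑ k, ℓ i (S k) + 2 * b S + r} with hA
  have hAm : ∀ m, NullMeasurableSet (A m) (Measure.pi fun _ => μ) := fun m => by
    simp only [hA, Set.ofPred_forall]
    exact (MeasurableSet.iInter fun i : Fin (m + 1) =>
      measurableSet_integral_le_add μ (hm i) hb r).nullMeasurableSet
  have hAanti : Antitone A := fun m m' h S hS i => hS (Fin.castLE (Nat.succ_le_succ h) i)
  have hAinter : {S | ∀ i, n * ∫ z, ℓ i z ∂μ ≤ ∑ k, ℓ i (S k) + 2 * b S + r} = ⋂ m, A m := by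
    ext S
    simp only [hA, Set.mem_iInter, Set.mem_ofPred_eq]
    exact ⟨fun h m i => h i, fun h i => h i (Fin.last i)⟩
  rw [hAinter]
  refine ge_of_tendsto' ((ENNReal.tendsto_toReal (measure_ne_top _ _)).comp
    (tendsto_measure_iInter_atTop hAm hAanti ⟨0, measure_ne_top _ _⟩)) fun m => ?_
  refine (le_measureReal_forall_integral_le_rademacherSup μ (ℓ := fun i : Fin (m + 1) => ℓ i)
    (fun i => hm i) (fun i => hℓ i) hn hδ₀ hδ₁).trans (measureReal_mono fun S hS i => ?_)
  linarith [hS i, hrad m S]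

lemma exists_measurableSet_forall_integral_le {Θ : Type*} [TopologicalSpace Θ]
    [TopologicalSpace.SeparableSpace Θ] [FirstCountableTopology Θ] {ℓ : Θ → Z → ℝ}
    (hm : ∀ θ, Measurable (ℓ θ)) (hc : ∀ z, Continuous fun θ => ℓ θ z)
    (hℓ : ∀ θ z, ℓ θ z ∈ Set.Icc (0 : ℝ) 1) {b : (Fin n → Z) → ℝ} (hb : Measurable b)
    (hrad : ∀ (m : ℕ) (θ : Fin (m + 1) → Θ) S, rademacherSup (fun i k => ℓ (θ i) (S k)) ≤ b S)
    (hn : 0 < n) {δ : ℝ} (hδ₀ : 0 < δ) (hδ₁ : δ ≤ 1) :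
    ∃ E : Set (Fin n → Z), MeasurableSet E ∧ 1 - δ ≤ (Measure.pi fun _ => μ).real E ∧
      ∀ S ∈ E, ∀ θ, n * ∫ z, ℓ θ z ∂μ ≤
        ∑ k, ℓ θ (S k) + 2 * b S + 3 * √(n * Real.log (1 / δ) / 2) := by
  rcases isEmpty_or_nonempty Θ with hΘ | hΘ
  · exact ⟨Set.univ, MeasurableSet.univ, by simpa using hδ₀.le, fun _ _ θ => hΘ.elim θ⟩
  set θ := TopologicalSpace.denseSeq Θ
  refine ⟨_, ?_, le_measureReal_forall_seq_integral_le μ (fun i => hm (θ i)) (fun i => hℓ (θ i))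
    hb (fun m S => hrad m (fun i => θ i) S) hn hδ₀ hδ₁, fun S hS => ?_⟩
  · rw [Set.ofPred_forall]
    exact MeasurableSet.iInter fun i => measurableSet_integral_le_add μ (hm (θ i)) hb _
  · have hcint : Continuous fun θ => ∫ z, ℓ θ z ∂μ :=
      continuous_of_dominated (bound := fun _ => 1) (fun θ => (hm θ).aestronglyMeasurable)
        (fun θ => .of_forall fun z => by
          rw [Real.norm_of_nonneg (hℓ θ z).1]
          exact (hℓ θ z).2) (integrable_const _) (.of_forall hc)
    refine isClosed_property (TopologicalSpace.denseRange_denseSeq Θ) (isClosed_le ?_ ?_) hS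
    · exact hcint.const_mul _
    · exact ((continuous_finsetSum _ fun k _ => hc (S k)).add_const _).add_const _

end UniformConvergence

/-! ### Chaining -/

section Chaining

variable {ι κ : Type*} [Nonempty ι] [Fintype κ] [DecidableEq κ]

lemma rademacherSup_le_sqrt_card_mul {u : ι → EuclideanSpace ℝ κ} {r : ℝ}
    (hu : ∀ i, ‖u i‖ ≤ r) : rademacherSup (fun i k => u i k) ≤ √(Fintype.card κ) * r := by
  rw [← Fintype.expect_const (ι := κ → Bool) (√(Fintype.card κ) * r)]
  refine Finset.expect_le_expect fun σ _ => ciSup_le fun i => ?_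
  calc ∑ k, sgn (σ k) * u i k ≤ √(∑ k, sgn (σ k) ^ 2) * √(∑ k, u i k ^ 2) :=
        Real.sum_mul_le_sqrt_mul_sqrt _ _ _
    _ = √(Fintype.card κ) * ‖u i‖ := by
        rw [← EuclideanSpace.real_norm_sq_eq, Real.sqrt_sq (norm_nonneg _)]
        simp [sq]
    _ ≤ √(Fintype.card κ) * r := by gcongr; exact hu i

variable [Finite ι]

lemma expect_exp_mul_ciSup_le {I : Type*} [Fintype I] (c : I → EuclideanSpace ℝ κ) (p : ι → I)
    {r : ℝ} (hc : ∀ i, ‖c (p i)‖ ≤ r) (t : ℝ) :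
    𝔼 σ : κ → Bool, Real.exp (t * ⨆ i, ∑ k, sgn (σ k) * c (p i) k) ≤
      Fintype.card I * Real.exp (t ^ 2 * r ^ 2 / 2) := by
  classical
  set J : Finset I := Finset.univ.filter fun j => ‖c j‖ ≤ r
  have hJ : ∀ j ∈ J, ‖c j‖ ≤ r := fun j hj => (Finset.mem_filter.1 hj).2
  calc 𝔼 σ : κ → Bool, Real.exp (t * ⨆ i, ∑ k, sgn (σ k) * c (p i) k)
      ≤ 𝔼 σ : κ → Bool, ∑ j ∈ J, Real.exp (∑ k, sgn (σ k) * (t * c j k)) := by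
        refine Finset.expect_le_expect fun σ _ => ?_
        obtain ⟨i, hi⟩ := exists_eq_ciSup_of_finite (f := fun i => ∑ k, sgn (σ k) * c (p i) k)
        have hpi : p i ∈ J := Finset.mem_filter.2 ⟨Finset.mem_univ _, hc i⟩
        simp only [← hi, Finset.mul_sum, mul_left_comm t]
        exact Finset.single_le_sum (f := fun j => Real.exp (∑ k, sgn (σ k) * (t * c j k)))
          (fun j _ => (Real.exp_pos _).le) hpi
    _ = ∑ j ∈ J, 𝔼 σ : κ → Bool, Real.exp (∑ k, sgn (σ k) * (t * c j k)) :=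
        Finset.expect_sum_comm _ _ _
    _ ≤ ∑ _j ∈ J, Real.exp (t ^ 2 * r ^ 2 / 2) := by
        refine Finset.sum_le_sum fun j hj => (expect_exp_sum_sgn_mul_le _).trans ?_
        simp only [mul_pow, ← Finset.mul_sum, ← EuclideanSpace.real_norm_sq_eq]
        gcongr
        exact hJ j hj
    _ ≤ Fintype.card I * Real.exp (t ^ 2 * r ^ 2 / 2) := by
        rw [Finset.sum_const, nsmul_eq_mul]
        gcongr
        exact Finset.card_le_univ J

/-- **Massart's finite class lemma**. -/
lemma rademacherSup_le_of_log_card_le {I : Type*} [Fintype I] (c : I → EuclideanSpace ℝ κ)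
    (p : ι → I) {r a : ℝ} (hr : 0 < r) (ha : 0 < a) (hc : ∀ i, ‖c (p i)‖ ≤ r)
    (hcard : Real.log (Fintype.card I) ≤ a) :
    rademacherSup (fun i k => c (p i) k) ≤ r * √(2 * a) := by
  have : Nonempty I := ⟨p (Classical.arbitrary ι)⟩
  set s := √(2 * a)
  have hs₀ : 0 < s := Real.sqrt_pos.2 (by linarith)
  have hss : s ^ 2 = 2 * a := Real.sq_sqrt (by linarith)
  have hexp : 𝔼 σ : κ → Bool, Real.exp (s / r * ⨆ i, ∑ k, sgn (σ k) * c (p i) k) ≤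
      Real.exp (2 * a) := by
    calc _ ≤ Fintype.card I * Real.exp ((s / r) ^ 2 * r ^ 2 / 2) :=
          expect_exp_mul_ciSup_le c p hc _
      _ = Fintype.card I * Real.exp a := by
          congr 2
          rw [← mul_pow, div_mul_cancel₀ _ hr.ne', hss, mul_div_cancel_left₀ _ two_ne_zero]
      _ ≤ Real.exp a * Real.exp a := by
          gcongr
          rwa [← Real.log_le_iff_le_exp (by exact_mod_cast Fintype.card_pos)]
      _ = Real.exp (2 * a) := by rw [← Real.exp_add, two_mul]
  have hmean := expect_le_of_expect_exp_le hexp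
  rw [← Finset.mul_expect, ← hss, sq, div_mul_eq_mul_div, div_le_iff₀ hr, mul_assoc] at hmean
  rw [mul_comm r]
  exact le_of_mul_le_mul_left hmean hs₀

variable {I : ℕ → Type*} [∀ j, Fintype (I j)] {c : ∀ j, I j → EuclideanSpace ℝ κ}
  {p : ∀ j, ι → I j} {v : ι → EuclideanSpace ℝ κ} {B a : ℝ}

lemma rademacherSup_le_add_of_eq_add {u v w : ι → EuclideanSpace ℝ κ} (h : ∀ i, v i = u i + w i) :
    rademacherSup (fun i k => v i k) ≤
      rademacherSup (fun i k => u i k) + rademacherSup (fun i k => w i k) := by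
  simpa only [h, PiLp.add_apply] using rademacherSup_add_le (fun i k => u i k) fun i k => w i k

lemma rademacherSup_chaining_zero_le (hB : 0 < B) (ha : 0 < a) (hv : ∀ i, ‖v i‖ ≤ B)
    (hc : ∀ i, ‖v i - c 0 (p 0 i)‖ ≤ B) (hcard : Real.log (Fintype.card (I 0)) ≤ 2 * a) :
    rademacherSup (fun i k => c 0 (p 0 i) k) ≤ 4 * B * √a := by
  have hnorm : ∀ i, ‖c 0 (p 0 i)‖ ≤ 2 * B := fun i => by
    linarith [hc i, hv i, norm_sub_rev (v i) (c 0 (p 0 i)),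
      norm_sub_norm_le (c 0 (p 0 i)) (v i)]
  calc rademacherSup (fun i k => c 0 (p 0 i) k) ≤ 2 * B * √(2 * (2 * a)) :=
        rademacherSup_le_of_log_card_le (c 0) (p 0) (by positivity) (by positivity) hnorm hcard
    _ = 2 * B * (2 * √a) := by
        rw [← mul_assoc, Real.sqrt_mul (by norm_num), Real.sqrt_mul_self zero_le_two]
    _ = 4 * B * √a := by ring

lemma rademacherSup_chaining_increment_le (hB : 0 < B) (ha : 0 < a)
    (hc : ∀ j i, ‖v i - c j (p j i)‖ ≤ B / 2 ^ j)
    (hcard : ∀ j, Real.log (Fintype.card (I j)) ≤ 2 * 4 ^ j * a) (N : ℕ) :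
    rademacherSup (fun i k => (c (N + 1) (p (N + 1) i) - c N (p N i)) k) ≤
      27 / 4 * B * √a := by
  have hI : ∀ j, Nonempty (I j) := fun j => ⟨p j (Classical.arbitrary ι)⟩
  have hnorm : ∀ i, ‖c (N + 1) (p (N + 1) i) - c N (p N i)‖ ≤ 3 / 2 * B / 2 ^ N := fun i => by
    calc _ ≤ ‖c (N + 1) (p (N + 1) i) - v i‖ + ‖v i - c N (p N i)‖ :=
          norm_sub_le_norm_sub_add_norm_sub _ _ _
      _ ≤ B / 2 ^ (N + 1) + B / 2 ^ N := by
          rw [norm_sub_rev]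
          exact add_le_add (hc _ i) (hc _ i)
      _ = 3 / 2 * B / 2 ^ N := by field_simp; ring
  have hprod : Real.log (Fintype.card (I N × I (N + 1))) ≤ 10 * 4 ^ N * a := by
    rw [Fintype.card_prod, Nat.cast_mul, Real.log_mul (by exact_mod_cast Fintype.card_ne_zero)
      (by exact_mod_cast Fintype.card_ne_zero)]
    linarith [hcard N, pow_succ (4 : ℝ) N ▸ hcard (N + 1)]
  have hsqrt : √(2 * (10 * 4 ^ N * a)) ≤ 9 / 2 * 2 ^ N * √a := by
    have hpos : 0 < 4 ^ N * a := by positivity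
    refine Real.sqrt_le_iff.2 ⟨by positivity, ?_⟩
    rw [mul_pow, Real.sq_sqrt ha.le, mul_pow, pow_right_comm]
    norm_num
    linarith
  calc _ ≤ 3 / 2 * B / 2 ^ N * √(2 * (10 * 4 ^ N * a)) :=
        rademacherSup_le_of_log_card_le (fun q : I N × I (N + 1) => c (N + 1) q.2 - c N q.1)
          (fun i => (p N i, p (N + 1) i)) (by positivity) (by positivity) hnorm hprod
    _ ≤ 3 / 2 * B / 2 ^ N * (9 / 2 * 2 ^ N * √a) := by gcongr
    _ = 27 / 4 * B * √a := by field_simp; ring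

lemma rademacherSup_chaining_le (hB : 0 < B) (ha : 0 < a) (hv : ∀ i, ‖v i‖ ≤ B)
    (hc : ∀ j i, ‖v i - c j (p j i)‖ ≤ B / 2 ^ j)
    (hcard : ∀ j, Real.log (Fintype.card (I j)) ≤ 2 * 4 ^ j * a) (N : ℕ) :
    rademacherSup (fun i k => c N (p N i) k) ≤ B * ((4 + 27 / 4 * N) * √a) := by
  induction N with
  | zero =>
    have h := rademacherSup_chaining_zero_le hB ha hv (fun i => by simpa using hc 0 i)
      (by simpa using hcard 0)
    simpa [mul_left_comm, mul_assoc] using h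
  | succ N ih =>
    have hadd := rademacherSup_le_add_of_eq_add (u := fun i => c N (p N i))
      (v := fun i => c (N + 1) (p (N + 1) i))
      (w := fun i => c (N + 1) (p (N + 1) i) - c N (p N i)) fun i => by abel
    have hinc := rademacherSup_chaining_increment_le hB ha hc hcard N
    push_cast
    linarith

/-- **Dudley's chaining bound**. -/
lemma rademacherSup_le_of_coverings (hB : 0 ≤ B) (ha : 0 < a) (hv : ∀ i, ‖v i‖ ≤ B)
    (hc : ∀ j i, ‖v i - c j (p j i)‖ ≤ B / 2 ^ j)
    (hcard : ∀ j, Real.log (Fintype.card (I j)) ≤ 2 * 4 ^ j * a) (N : ℕ) :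
    rademacherSup (fun i k => v i k) ≤
      B * ((4 + 27 / 4 * N) * √a + √(Fintype.card κ) / 2 ^ N) := by
  rcases hB.eq_or_lt with rfl | hB
  · simpa using rademacherSup_le_sqrt_card_mul hv
  have hadd := rademacherSup_le_add_of_eq_add (u := fun i => c N (p N i)) (v := v)
    (w := fun i => v i - c N (p N i)) fun i => by abel
  have hcenter := rademacherSup_chaining_le hB ha hv hc hcard N
  have hrest := rademacherSup_le_sqrt_card_mul (hc N)
  calc _ ≤ B * ((4 + 27 / 4 * N) * √a) + √(Fintype.card κ) * (B / 2 ^ N) := by linarith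
    _ = B * ((4 + 27 / 4 * N) * √a + √(Fintype.card κ) / 2 ^ N) := by ring

end Chaining

/-! ### Maurey sparsification -/

section Maurey

lemma exists_le_of_sum_mul_le {J : Type*} [Fintype J] {w f : J → ℝ} {c : ℝ} (hw₀ : ∀ j, 0 ≤ w j)
    (hw₁ : ∑ j, w j = 1) (h : ∑ j, w j * f j ≤ c) : ∃ j, f j ≤ c := by
  by_contra! hlt
  obtain ⟨j, -, hj⟩ := Finset.exists_ne_zero_of_sum_ne_zero (hw₁.trans_ne one_ne_zero)
  have hsum : ∑ j, w j * c < ∑ j, w j * f j :=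
    Finset.sum_lt_sum (fun j _ => mul_le_mul_of_nonneg_left (hlt j).le (hw₀ j))
      ⟨j, Finset.mem_univ j, mul_lt_mul_of_pos_left (hlt j) ((hw₀ j).lt_of_ne' hj)⟩
  rw [← Finset.sum_mul, hw₁, one_mul] at hsum
  exact hsum.not_ge h

variable {H : Type*} [NormedAddCommGroup H] [InnerProductSpace ℝ H] {J : Type*} [Fintype J]

lemma exists_norm_add_sub_sq_le {V : J → H} {w : J → ℝ} (hw₀ : ∀ j, 0 ≤ w j)
    (hw₁ : ∑ j, w j = 1) {B : ℝ} (hV : ∀ j, ‖V j‖ ≤ B) (r : H) :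
    ∃ j, ‖r + (∑ j, w j • V j - V j)‖ ^ 2 ≤ ‖r‖ ^ 2 + B ^ 2 := by
  set y := ∑ j, w j • V j with hy
  have hexpand : ∀ j, w j * ‖r + (y - V j)‖ ^ 2 =
      w j * ‖r + y‖ ^ 2 - 2 * inner ℝ (r + y) (w j • V j) + w j * ‖V j‖ ^ 2 := fun j => by
    rw [← add_sub_assoc, norm_sub_sq_real, inner_smul_right]
    ring
  have hbias : ‖r + y‖ ^ 2 - 2 * inner ℝ (r + y) y ≤ ‖r‖ ^ 2 := by
    have h := norm_sub_sq_real (r + y) y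
    rw [add_sub_cancel_right] at h
    linarith [sq_nonneg ‖y‖]
  have hvar : ∑ j, w j * ‖V j‖ ^ 2 ≤ B ^ 2 := by
    calc ∑ j, w j * ‖V j‖ ^ 2 ≤ ∑ j, w j * B ^ 2 := by
          gcongr with j _
          · exact hw₀ j
          · exact hV j
      _ = B ^ 2 := by rw [← Finset.sum_mul, hw₁, one_mul]
  refine exists_le_of_sum_mul_le hw₀ hw₁ ?_
  simp only [hexpand]
  rw [Finset.sum_add_distrib, Finset.sum_sub_distrib, ← Finset.sum_mul, hw₁, one_mul,
    ← Finset.mul_sum, ← inner_sum, ← hy]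
  exact add_le_add hbias hvar

lemma exists_norm_smul_sub_sum_sq_le {V : J → H} {w : J → ℝ} (hw₀ : ∀ j, 0 ≤ w j)
    (hw₁ : ∑ j, w j = 1) {B : ℝ} (hV : ∀ j, ‖V j‖ ≤ B) (k : ℕ) :
    ∃ g : Fin k → J, ‖(k : ℝ) • (∑ j, w j • V j) - ∑ i, V (g i)‖ ^ 2 ≤ k * B ^ 2 := by
  induction k with
  | zero => exact ⟨Fin.elim0, by simp⟩
  | succ k ih =>
    obtain ⟨g, hg⟩ := ih
    obtain ⟨j, hj⟩ := exists_norm_add_sub_sq_le hw₀ hw₁ hV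
      ((k : ℝ) • (∑ j, w j • V j) - ∑ i, V (g i))
    refine ⟨Fin.cons j g, ?_⟩
    have hsplit : ((k + 1 : ℕ) : ℝ) • (∑ j, w j • V j) -
        ∑ i, V ((Fin.cons j g : Fin (k + 1) → J) i) =
        ((k : ℝ) • (∑ j, w j • V j) - ∑ i, V (g i)) + (∑ j, w j • V j - V j) := by
      simp only [Fin.sum_univ_succ, Fin.cons_zero, Fin.cons_succ, Nat.cast_succ, add_smul,
        one_smul]
      abel
    rw [hsplit, Nat.cast_succ]
    linarith

lemma exists_norm_sum_smul_sub_mean_le {V : J → H} {w : J → ℝ} (hw₀ : ∀ j, 0 ≤ w j)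
    (hw₁ : ∑ j, w j = 1) {B : ℝ} (hB : 0 ≤ B) (hV : ∀ j, ‖V j‖ ≤ B) {k : ℕ} (hk : 0 < k) :
    ∃ g : Fin k → J, ‖∑ j, w j • V j - (k : ℝ)⁻¹ • ∑ i, V (g i)‖ ≤ B / √k := by
  have hk₀ : (0 : ℝ) < k := by exact_mod_cast hk
  obtain ⟨g, hg⟩ := exists_norm_smul_sub_sum_sq_le hw₀ hw₁ hV k
  refine ⟨g, ?_⟩
  have hscale : ∑ j, w j • V j - (k : ℝ)⁻¹ • ∑ i, V (g i) =
      (k : ℝ)⁻¹ • ((k : ℝ) • (∑ j, w j • V j) - ∑ i, V (g i)) := by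
    rw [smul_sub, inv_smul_smul₀ hk₀.ne']
  have hnorm := Real.le_sqrt_of_sq_le hg
  rw [Real.sqrt_mul hk₀.le, Real.sqrt_sq hB] at hnorm
  calc _ = (k : ℝ)⁻¹ * ‖(k : ℝ) • (∑ j, w j • V j) - ∑ i, V (g i)‖ := by
        rw [hscale, norm_smul, norm_inv, Real.norm_natCast]
    _ ≤ (k : ℝ)⁻¹ * (√k * B) := by gcongr
    _ = B / √k := by
        rw [← mul_assoc, inv_mul_eq_div, Real.sqrt_div_self', one_div_mul_eq_div]

end Maurey

lemma div_mul_norm_le {H : Type*} [NormedAddCommGroup H] {r : ℝ} (hr : 0 ≤ r) (u : H) :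
    r / ‖u‖ * ‖u‖ ≤ r := by
  rw [div_mul_eq_mul_div]
  exact div_le_of_le_mul₀ (norm_nonneg _) hr le_rfl

section Atoms

variable {H : Type*} [NormedAddCommGroup H] [NormedSpace ℝ H] {J : Type*}

/-- The dictionary used to sparsify combinations of the vectors `U j`: the vectors
`± B U j / ‖U j‖` together with `0`. It depends on the `U j` only, so that its size governs the
covering numbers. -/
noncomputable def atom (B : ℝ) (U : J → H) : Option (J × Bool) → H
  | none => 0
  | some (j, b) => (sgn b * (B / ‖U j‖)) • U j

/-- The average of `k` atoms selected by `g`. -/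
noncomputable def atomMean (B : ℝ) (U : J → H) (k : ℕ) (g : Fin k → Option (J × Bool)) : H :=
  (k : ℝ)⁻¹ • ∑ i, atom B U (g i)

lemma norm_atom_le {B : ℝ} (hB : 0 ≤ B) (U : J → H) : ∀ o, ‖atom B U o‖ ≤ B
  | none => by simpa [atom] using hB
  | some (j, b) => by
    rw [atom, norm_smul, Real.norm_eq_abs, abs_mul, abs_sgn, one_mul, abs_div, abs_norm,
      abs_of_nonneg hB]
    exact div_mul_norm_le hB _

variable [Fintype J] {U : J → H} {α : J → ℝ} {B : ℝ}

lemma mul_norm_div_mul_div_norm_smul (hα : ∑ j, |α j| * ‖U j‖ ≤ B) (j : J) :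
    (α j * ‖U j‖ / B * (B / ‖U j‖)) • U j = α j • U j := by
  rcases eq_or_ne (U j) 0 with hU | hU
  · simp [hU]
  rcases eq_or_ne B 0 with rfl | hB
  · have hj : |α j| * ‖U j‖ ≤ 0 := (Finset.single_le_sum (f := fun j => |α j| * ‖U j‖)
      (fun j _ => by positivity) (Finset.mem_univ j)).trans hα
    have hzero : α j • U j = 0 := by rwa [← norm_le_zero_iff, norm_smul]
    simp [hzero]
  · have hU' : ‖U j‖ ≠ 0 := norm_ne_zero_iff.2 hU
    field_simp

lemma exists_weights_sum_smul_atom_eq (hα : ∑ j, |α j| * ‖U j‖ ≤ B) :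
    ∃ w : Option (J × Bool) → ℝ, (∀ o, 0 ≤ w o) ∧ ∑ o, w o = 1 ∧
      ∑ o, w o • atom B U o = ∑ j, α j • U j := by
  have hB : 0 ≤ B := (Finset.sum_nonneg fun j _ => by positivity).trans hα
  set β : J → ℝ := fun j => α j * ‖U j‖ / B with hβ
  have hβsum : ∑ j, |β j| ≤ 1 := by
    simp only [hβ, abs_div, abs_mul, abs_norm, abs_of_nonneg hB, ← Finset.sum_div]
    exact div_le_one_of_le₀ hα hB
  refine ⟨fun o => o.elim (1 - ∑ j, |β j|) fun q => (|β q.1| + sgn q.2 * β q.1) / 2, ?_, ?_, ?_⟩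
  · rintro (_ | ⟨j, b⟩)
    · simpa using hβsum
    · have h := neg_abs_le (sgn b * β j)
      rw [abs_mul, abs_sgn, one_mul] at h
      simp only [Option.elim_some]
      linarith
  · have hpair : ∀ j, (|β j| + sgn true * β j) / 2 + (|β j| + sgn false * β j) / 2 = |β j| :=
      fun j => by
        simp only [sgn, if_true, Bool.false_eq_true, if_false]
        ring
    simp only [Fintype.sum_option, Fintype.sum_prod_type, Option.elim_none, Option.elim_some,
      Fintype.sum_bool, hpair, sub_add_cancel]
  · simp only [Fintype.sum_option, Fintype.sum_prod_type, Option.elim_none, Option.elim_some,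
      Fintype.sum_bool, atom, smul_zero, zero_add]
    refine Finset.sum_congr rfl fun j _ => ?_
    rw [← mul_norm_div_mul_div_norm_smul hα j, smul_smul, smul_smul, ← add_smul]
    congr 1
    simp only [sgn, if_true, Bool.false_eq_true, if_false]
    ring

end Atoms

lemma exists_norm_sub_atomMean_le {H : Type*} [NormedAddCommGroup H] [InnerProductSpace ℝ H]
    {J : Type*} [Fintype J] {U : J → H} {α : J → ℝ} {B : ℝ} (hα : ∑ j, |α j| * ‖U j‖ ≤ B) {k : ℕ}
    (hk : 0 < k) : ∃ g, ‖∑ j, α j • U j - atomMean B U k g‖ ≤ B / √k := by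
  have hB : 0 ≤ B := (Finset.sum_nonneg fun j _ => by positivity).trans hα
  obtain ⟨w, hw₀, hw₁, hw⟩ := exists_weights_sum_smul_atom_eq hα
  simpa only [hw, atomMean] using exists_norm_sum_smul_sub_mean_le hw₀ hw₁ hB (norm_atom_le hB U) hk

section BallProjection

variable {H : Type*} [NormedAddCommGroup H]

/-- The metric projection of a real inner product space onto the closed ball of radius `r` around
`0`. -/
noncomputable def ballProj [NormedSpace ℝ H] (r : ℝ) (u : H) : H :=
  if ‖u‖ ≤ r then u else (r / ‖u‖) • u

lemma norm_ballProj_le [NormedSpace ℝ H] {r : ℝ} (hr : 0 ≤ r) (u : H) : ‖ballProj r u‖ ≤ r := by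
  unfold ballProj
  split_ifs with h
  · exact h
  · rw [norm_smul, norm_div, norm_norm, Real.norm_of_nonneg hr]
    exact div_mul_norm_le hr _

lemma norm_sub_ballProj_le [InnerProductSpace ℝ H] {r : ℝ} (hr : 0 ≤ r) (u : H) {v : H}
    (hv : ‖v‖ ≤ r) : ‖v - ballProj r u‖ ≤ ‖v - u‖ := by
  unfold ballProj
  split_ifs with h
  · exact le_rfl
  have hu : 0 < ‖u‖ := hr.trans_lt (not_le.1 h)
  have hcu : r / ‖u‖ * ‖u‖ = r := div_mul_cancel₀ _ hu.ne'
  have hc : r / ‖u‖ ≤ 1 := (div_le_one hu).2 (not_le.1 h).le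
  have hinner : inner ℝ v u ≤ r * ‖u‖ :=
    (real_inner_le_norm v u).trans (mul_le_mul_of_nonneg_right hv hu.le)
  refine le_of_sq_le_sq ?_ (norm_nonneg _)
  rw [norm_sub_sq_real, norm_sub_sq_real, inner_smul_right, norm_smul, norm_div, norm_norm,
    Real.norm_of_nonneg hr, hcu]
  nlinarith [mul_le_mul_of_nonneg_left hinner (sub_nonneg.2 hc)]

end BallProjection

/-! ### Coverings of the network class -/

section Cover

variable {S : Type*} {m p : ℕ}

/-- The matrix `W` applied to each of the vectors `z (s, ·)`. -/
noncomputable def rowMap (W : Matrix (Fin m) (Fin p) ℝ) (z : EuclideanSpace ℝ (S × Fin p)) :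
    EuclideanSpace ℝ (S × Fin m) :=
  WithLp.toLp 2 fun q => ∑ i, W q.2 i * z (q.1, i)

/-- The image of `z` under `rowMap` of the matrix unit with index `j`. -/
noncomputable def unitImage (m : ℕ) (z : EuclideanSpace ℝ (S × Fin p)) (j : Fin m × Fin p) :
    EuclideanSpace ℝ (S × Fin m) :=
  WithLp.toLp 2 fun q => if q.2 = j.1 then z (q.1, j.2) else 0

/-- The coordinatewise positive part. -/
noncomputable def reluMap (z : EuclideanSpace ℝ (S × Fin m)) : EuclideanSpace ℝ (S × Fin m) :=
  WithLp.toLp 2 fun q => max (z q) 0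

lemma rowMap_eq_sum (W : Matrix (Fin m) (Fin p) ℝ) (z : EuclideanSpace ℝ (S × Fin p)) :
    rowMap W z = ∑ j : Fin m × Fin p, W j.1 j.2 • unitImage m z j := by
  ext q
  simp [rowMap, unitImage, Fintype.sum_prod_type]

lemma rowMap_sub (W : Matrix (Fin m) (Fin p) ℝ) (z z' : EuclideanSpace ℝ (S × Fin p)) :
    rowMap W (z - z') = rowMap W z - rowMap W z' := by
  ext q
  simp [rowMap, mul_sub]

variable [Fintype S]

lemma norm_unitImage (z : EuclideanSpace ℝ (S × Fin p)) (j : Fin m × Fin p) :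
    ‖unitImage m z j‖ = √(∑ s, z (s, j.2) ^ 2) := by
  simp [EuclideanSpace.norm_eq, unitImage, Fintype.sum_prod_type, ite_pow]

lemma sum_abs_mul_norm_unitImage_le (W : Matrix (Fin m) (Fin p) ℝ)
    (z : EuclideanSpace ℝ (S × Fin p)) :
    ∑ j : Fin m × Fin p, |W j.1 j.2| * ‖unitImage m z j‖ ≤ normTwoOne Wᵀ * ‖z‖ := by
  have hz : ‖z‖ = √(∑ i, √(∑ s, z (s, i) ^ 2) ^ 2) := by
    have hcol : ∀ i, √(∑ s, z (s, i) ^ 2) ^ 2 = ∑ s, z (s, i) ^ 2 := fun i =>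
      Real.sq_sqrt (by positivity)
    simp only [hcol, EuclideanSpace.norm_eq, Real.norm_eq_abs, sq_abs]
    rw [Fintype.sum_prod_type_right]
  rw [Fintype.sum_prod_type, normTwoOne, Finset.sum_mul]
  refine Finset.sum_le_sum fun k _ => ?_
  simpa only [norm_unitImage, hz, sq_abs, Matrix.transpose_apply] using
    Real.sum_mul_le_sqrt_mul_sqrt Finset.univ (fun i => |W k i|) fun i => √(∑ s, z (s, i) ^ 2)

lemma norm_rowMap_le_normTwoOne (W : Matrix (Fin m) (Fin p) ℝ)
    (z : EuclideanSpace ℝ (S × Fin p)) : ‖rowMap W z‖ ≤ normTwoOne Wᵀ * ‖z‖ := by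
  calc ‖rowMap W z‖ ≤ ∑ j : Fin m × Fin p, ‖W j.1 j.2 • unitImage m z j‖ := by
        rw [rowMap_eq_sum]
        exact norm_sum_le _ _
    _ = ∑ j : Fin m × Fin p, |W j.1 j.2| * ‖unitImage m z j‖ := by
        simp only [norm_smul, Real.norm_eq_abs]
    _ ≤ normTwoOne Wᵀ * ‖z‖ := sum_abs_mul_norm_unitImage_le W z

lemma norm_rowMap_le_spectralNorm (W : Matrix (Fin m) (Fin p) ℝ)
    (z : EuclideanSpace ℝ (S × Fin p)) : ‖rowMap W z‖ ≤ spectralNorm W * ‖z‖ := by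
  refine le_of_sq_le_sq ?_ (mul_nonneg (norm_nonneg _) (norm_nonneg _))
  rw [mul_pow, EuclideanSpace.real_norm_sq_eq, EuclideanSpace.real_norm_sq_eq,
    Fintype.sum_prod_type, Fintype.sum_prod_type, Finset.mul_sum]
  refine Finset.sum_le_sum fun s _ => ?_
  have h := pow_le_pow_left₀ (norm_nonneg _)
    ((Matrix.toEuclideanLin (𝕜 := ℝ) W).toContinuousLinearMap.le_opNorm
      (WithLp.toLp 2 fun i => z (s, i))) 2
  rw [mul_pow, EuclideanSpace.real_norm_sq_eq, EuclideanSpace.real_norm_sq_eq] at h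
  simpa [rowMap, Matrix.toLpLin_apply, Matrix.mulVec, dotProduct, spectralNorm] using h

lemma norm_reluMap_sub_le (z z' : EuclideanSpace ℝ (S × Fin m)) :
    ‖reluMap z - reluMap z'‖ ≤ ‖z - z'‖ := by
  refine le_of_sq_le_sq ?_ (norm_nonneg _)
  rw [EuclideanSpace.real_norm_sq_eq, EuclideanSpace.real_norm_sq_eq]
  exact Finset.sum_le_sum fun q _ => sq_le_sq.2 (abs_max_sub_max_le_abs _ _ _)

lemma norm_reluMap_le (z : EuclideanSpace ℝ (S × Fin m)) : ‖reluMap z‖ ≤ ‖z‖ := by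
  have hzero : reluMap (0 : EuclideanSpace ℝ (S × Fin m)) = 0 := by
    ext q
    simp [reluMap]
  simpa [hzero] using norm_reluMap_sub_le z 0

lemma normTwoOne_transpose_le_entryNormOne (W : Matrix (Fin m) (Fin p) ℝ) :
    normTwoOne Wᵀ ≤ entryNormOne W := by
  refine Finset.sum_le_sum fun k _ => Real.sqrt_le_iff.2 ⟨by positivity, ?_⟩
  calc ∑ i, Wᵀ i k ^ 2 = ∑ i, |W k i| ^ 2 := by simp
    _ ≤ (∑ i, |W k i|) ^ 2 := Finset.sum_sq_le_sq_sum_of_nonneg fun i _ => abs_nonneg _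

lemma exists_norm_rowMap_sub_atomMean_le {W : Matrix (Fin m) (Fin p) ℝ}
    {z : EuclideanSpace ℝ (S × Fin p)} {B : ℝ} (hW : normTwoOne Wᵀ * ‖z‖ ≤ B) {k : ℕ}
    (hk : 0 < k) : ∃ g, ‖rowMap W z - atomMean B (unitImage m z) k g‖ ≤ B / √k := by
  rw [rowMap_eq_sum]
  exact exists_norm_sub_atomMean_le ((sum_abs_mul_norm_unitImage_le W z).trans hW) hk

variable {d d₁ K : ℕ} {s₁ s₂ b₁ b₂ : ℝ}

/-- The value of the network on the whole sample `X`. -/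
noncomputable def netMap (W₁ : Matrix (Fin d₁) (Fin d) ℝ) (W₂ : Matrix (Fin K) (Fin d₁) ℝ)
    (X : EuclideanSpace ℝ (S × Fin d)) : EuclideanSpace ℝ (S × Fin K) :=
  rowMap W₂ (reluMap (rowMap W₁ X))

/-- The element of the covering of the network class selected by two choices of `k` atoms. The
hidden layer is projected onto the ball containing all hidden layers of the class, which gives the
second covering a common scale. -/
noncomputable def coverCenter (s₁ b₁ b₂ : ℝ) (X : EuclideanSpace ℝ (S × Fin d)) (k : ℕ)
    (g : (Fin k → Option ((Fin d₁ × Fin d) × Bool)) ×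
      (Fin k → Option ((Fin K × Fin d₁) × Bool))) : EuclideanSpace ℝ (S × Fin K) :=
  atomMean (b₂ * (s₁ * ‖X‖)) (unitImage K
    (ballProj (s₁ * ‖X‖) (reluMap (atomMean (b₁ * ‖X‖) (unitImage d₁ X) k g.1)))) k g.2

section InClass

variable {W₁ : Matrix (Fin d₁) (Fin d) ℝ} {W₂ : Matrix (Fin K) (Fin d₁) ℝ}

lemma normTwoOne_nonneg (W : Matrix (Fin m) (Fin p) ℝ) : 0 ≤ normTwoOne W :=
  Finset.sum_nonneg fun _ _ => Real.sqrt_nonneg _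

lemma entryNormOne_nonneg (W : Matrix (Fin m) (Fin p) ℝ) : 0 ≤ entryNormOne W :=
  Finset.sum_nonneg fun _ _ => Finset.sum_nonneg fun _ _ => abs_nonneg _

lemma InClass.s₁_nonneg (h : InClass s₁ s₂ b₁ b₂ W₁ W₂) : 0 ≤ s₁ := (norm_nonneg _).trans h.1

lemma InClass.s₂_nonneg (h : InClass s₁ s₂ b₁ b₂ W₁ W₂) : 0 ≤ s₂ := (norm_nonneg _).trans h.2.1

lemma InClass.b₁_nonneg (h : InClass s₁ s₂ b₁ b₂ W₁ W₂) : 0 ≤ b₁ :=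
  (entryNormOne_nonneg W₁).trans h.2.2.1

lemma InClass.b₂_nonneg (h : InClass s₁ s₂ b₁ b₂ W₁ W₂) : 0 ≤ b₂ :=
  (normTwoOne_nonneg _).trans h.2.2.2

lemma InClass.normTwoOne_le (h : InClass s₁ s₂ b₁ b₂ W₁ W₂) : normTwoOne W₁ᵀ ≤ b₁ :=
  (normTwoOne_transpose_le_entryNormOne W₁).trans h.2.2.1

lemma InClass.norm_hidden_le (h : InClass s₁ s₂ b₁ b₂ W₁ W₂) (X : EuclideanSpace ℝ (S × Fin d)) :
    ‖reluMap (rowMap W₁ X)‖ ≤ s₁ * ‖X‖ :=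
  (norm_reluMap_le _).trans <| (norm_rowMap_le_spectralNorm W₁ X).trans <|
    mul_le_mul_of_nonneg_right h.1 (norm_nonneg _)

lemma InClass.norm_netMap_le (h : InClass s₁ s₂ b₁ b₂ W₁ W₂) (X : EuclideanSpace ℝ (S × Fin d)) :
    ‖netMap W₁ W₂ X‖ ≤ s₂ * b₁ * ‖X‖ := by
  have hs₂ := h.s₂_nonneg
  calc ‖netMap W₁ W₂ X‖ ≤ spectralNorm W₂ * ‖reluMap (rowMap W₁ X)‖ :=
        norm_rowMap_le_spectralNorm _ _
    _ ≤ s₂ * ‖rowMap W₁ X‖ := mul_le_mul h.2.1 (norm_reluMap_le _) (norm_nonneg _) hs₂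
    _ ≤ s₂ * (b₁ * ‖X‖) := by
        gcongr
        exact (norm_rowMap_le_normTwoOne _ _).trans (by gcongr; exact h.normTwoOne_le)
    _ = s₂ * b₁ * ‖X‖ := (mul_assoc _ _ _).symm

lemma InClass.exists_norm_sub_coverCenter_le (h : InClass s₁ s₂ b₁ b₂ W₁ W₂)
    (X : EuclideanSpace ℝ (S × Fin d)) {k : ℕ} (hk : 0 < k) :
    ∃ g, ‖netMap W₁ W₂ X - coverCenter (d₁ := d₁) s₁ b₁ b₂ X k g‖ ≤
      (s₂ * b₁ + s₁ * b₂) * ‖X‖ / √k := by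
  have hr : 0 ≤ s₁ * ‖X‖ := mul_nonneg h.s₁_nonneg (norm_nonneg _)
  obtain ⟨g₁, hg₁⟩ := exists_norm_rowMap_sub_atomMean_le (S := S)
    (mul_le_mul_of_nonneg_right h.normTwoOne_le (norm_nonneg X)) hk
  set z := ballProj (s₁ * ‖X‖) (reluMap (atomMean (b₁ * ‖X‖) (unitImage d₁ X) k g₁))
  obtain ⟨g₂, hg₂⟩ := exists_norm_rowMap_sub_atomMean_le (W := W₂) (z := z)
    (mul_le_mul h.2.2.2 (norm_ballProj_le hr _) (norm_nonneg _) h.b₂_nonneg) hk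
  refine ⟨(g₁, g₂), ?_⟩
  have hz : ‖reluMap (rowMap W₁ X) - z‖ ≤ b₁ * ‖X‖ / √k :=
    (norm_sub_ballProj_le hr _ (h.norm_hidden_le X)).trans ((norm_reluMap_sub_le _ _).trans hg₁)
  calc _ ≤ ‖netMap W₁ W₂ X - rowMap W₂ z‖ + ‖rowMap W₂ z - coverCenter s₁ b₁ b₂ X k (g₁, g₂)‖ :=
        norm_sub_le_norm_sub_add_norm_sub _ _ _
    _ ≤ s₂ * (b₁ * ‖X‖ / √k) + b₂ * (s₁ * ‖X‖) / √k := by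
        refine add_le_add ?_ hg₂
        rw [netMap, ← rowMap_sub]
        exact (norm_rowMap_le_spectralNorm _ _).trans
          (mul_le_mul h.2.1 hz (norm_nonneg _) h.s₂_nonneg)
    _ = (s₂ * b₁ + s₁ * b₂) * ‖X‖ / √k := by ring

end InClass

end Cover

/-! ### The semidefinite relaxation -/

section Sdp

lemma abs_apply_le_one_of_posSemidef {ι : Type*} [Finite ι] {P : Matrix ι ι ℝ}
    (hP : P.PosSemidef) (hd : ∀ i, P i i ≤ 1) (i j : ι) : |P i j| ≤ 1 := by
  classical
  have := Fintype.ofFinite ι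
  have hsymm : P j i = P i j := by simpa using hP.1.apply i j
  have hquad : ∀ s : ℝ, 0 ≤ P i i + s * P i j + (s * P j i + s * s * P j j) := fun s => by
    have h := hP.dotProduct_mulVec_nonneg (Pi.single i 1 + Pi.single j s)
    simp [Matrix.mulVec_add, add_dotProduct, dotProduct_add] at h
    linarith
  exact abs_le.2 ⟨by linarith [hquad 1, hd i, hd j], by linarith [hquad (-1), hd i, hd j]⟩

lemma sum_mul_le_sdpMax {ι : Type} [Fintype ι] (A : Matrix ι ι ℝ) {P : Matrix ι ι ℝ}
    (hP : P.PosSemidef) (hd : ∀ i, P i i ≤ 1) : ∑ i, ∑ j, A i j * P i j ≤ sdpMax A := by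
  refine le_csSup ⟨∑ i, ∑ j, |A i j|, ?_⟩ ⟨P, hP, hd, rfl⟩
  rintro _ ⟨P, hP, hd, rfl⟩
  refine Finset.sum_le_sum fun i _ => Finset.sum_le_sum fun j _ => ?_
  calc A i j * P i j ≤ |A i j| * |P i j| := (le_abs_self _).trans (abs_mul _ _).le
    _ ≤ |A i j| := mul_le_of_le_one_right (abs_nonneg _) (abs_apply_le_one_of_posSemidef hP hd i j)

variable {d d₁ K : ℕ}

lemma neg_Q (v : Fin d₁ → ℝ) (W : Matrix (Fin d₁) (Fin d) ℝ) : -Q v W = Q (-v) W := by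
  ext (_ | _ | _) (_ | _ | _) <;>
    simp [Q, Matrix.vecMul, dotProduct, Matrix.diagonal_mul]

lemma sum_Q_mul (v : Fin d₁ → ℝ) (W : Matrix (Fin d₁) (Fin d) ℝ)
    (P : Matrix (Unit ⊕ (Fin d ⊕ Fin d₁)) (Unit ⊕ (Fin d ⊕ Fin d₁)) ℝ) :
    ∑ a, ∑ b, Q v W a b * P a b = ∑ i, ∑ j, v i * W i j *
      (P (.inl ()) (.inr (.inl j)) + P (.inr (.inl j)) (.inl ()) +
        P (.inr (.inr i)) (.inr (.inl j)) + P (.inr (.inl j)) (.inr (.inr i))) := by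
  have hrow : ∑ j, (∑ i, v i * W i j) * P (.inl ()) (.inr (.inl j)) =
      ∑ i, ∑ j, v i * W i j * P (.inl ()) (.inr (.inl j)) := by
    simp only [Finset.sum_mul]
    exact Finset.sum_comm
  have hcol : ∑ j, (∑ i, v i * W i j) * P (.inr (.inl j)) (.inl ()) =
      ∑ i, ∑ j, v i * W i j * P (.inr (.inl j)) (.inl ()) := by
    simp only [Finset.sum_mul]
    exact Finset.sum_comm
  have hblock : ∑ j, ∑ i, v i * W i j * P (.inr (.inl j)) (.inr (.inr i)) =
      ∑ i, ∑ j, v i * W i j * P (.inr (.inl j)) (.inr (.inr i)) := Finset.sum_comm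
  simp only [Q, Fintype.sum_sum_type, Matrix.fromBlocks_apply₁₁, Matrix.fromBlocks_apply₁₂,
    Matrix.fromBlocks_apply₂₁, Matrix.fromBlocks_apply₂₂, Matrix.fromCols_apply_inl,
    Matrix.fromCols_apply_inr, Matrix.fromRows_apply_inl, Matrix.fromRows_apply_inr,
    Matrix.zero_apply, Finset.sum_const_zero, Matrix.transpose_apply, zero_mul,
    Matrix.replicateRow_apply, Matrix.diagonal_mul, Finset.univ_unique, Matrix.vecMul, dotProduct,
    Pi.one_apply, one_mul, Finset.sum_singleton, Finset.sum_add_distrib, add_zero, zero_add,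
    PUnit.default_eq_unit, hrow, hcol, hblock, mul_add]
  ring

lemma sdpMax_Q_le (v : Fin d₁ → ℝ) (W : Matrix (Fin d₁) (Fin d) ℝ) :
    sdpMax (Q v W) ≤ 4 * ∑ i, ∑ j, |v i| * |W i j| := by
  refine Real.sSup_le ?_ (by positivity)
  rintro _ ⟨P, hP, hd, rfl⟩
  have hle := fun a b => (abs_le.1 (abs_apply_le_one_of_posSemidef hP hd a b))
  rw [sum_Q_mul]
  simp only [Finset.mul_sum]
  refine Finset.sum_le_sum fun i _ => Finset.sum_le_sum fun j _ => ?_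
  rw [← abs_mul, mul_comm 4]
  refine (le_abs_self _).trans ?_
  rw [abs_mul]
  refine mul_le_mul_of_nonneg_left (abs_le.2 ⟨?_, ?_⟩) (abs_nonneg _) <;>
    linarith [hle (.inl ()) (.inr (.inl j)), hle (.inr (.inl j)) (.inl ()),
      hle (.inr (.inr i)) (.inr (.inl j)), hle (.inr (.inl j)) (.inr (.inr i))]

lemma two_mul_sum_le_sdpMax_Q (v : Fin d₁ → ℝ) (W : Matrix (Fin d₁) (Fin d) ℝ) {t : Fin d → ℝ}
    {u : Fin d₁ → ℝ} (ht : ∀ j, |t j| ≤ 1) (hu : ∀ i, |u i| ≤ 1) :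
    2 * ∑ i, (1 + u i) * v i * (W *ᵥ t) i ≤ sdpMax (Q v W) := by
  set p : Unit ⊕ (Fin d ⊕ Fin d₁) → ℝ := Sum.elim (fun _ => 1) (Sum.elim t u) with hp
  have hpsd : (Matrix.vecMulVec p p).PosSemidef := by
    simpa using Matrix.posSemidef_vecMulVec_self_star p
  have hle : ∀ a, |p a| ≤ 1 := by
    rintro (_ | j | i)
    · simp [hp]
    · exact ht j
    · exact hu i
  have hd : ∀ a, (Matrix.vecMulVec p p) a a ≤ 1 := fun a => by
    rw [Matrix.vecMulVec_apply, ← abs_mul_abs_self]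
    exact mul_le_one₀ (hle a) (abs_nonneg _) (hle a)
  refine le_trans (le_of_eq ?_) (sum_mul_le_sdpMax (Q v W) hpsd hd)
  rw [sum_Q_mul]
  simp only [Matrix.vecMulVec_apply, hp, Sum.elim_inl, Sum.elim_inr, Matrix.mulVec,
    dotProduct, Finset.mul_sum]
  exact Finset.sum_congr rfl fun i _ => Finset.sum_congr rfl fun j _ => by ring

variable (W₁ : Matrix (Fin d₁) (Fin d) ℝ) (W₂ : Matrix (Fin K) (Fin d₁) ℝ)

lemma sdpTerm_nonneg : 0 ≤ sdpTerm W₁ W₂ :=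
  Real.iSup_nonneg fun k => le_max_of_le_left <| by
    simpa using sum_mul_le_sdpMax (Q (W₂ k) W₁) (P := 0) Matrix.PosSemidef.zero (by simp)

lemma abs_two_mul_sum_le_sdpTerm (k : Fin K) {t : Fin d → ℝ} {u : Fin d₁ → ℝ}
    (ht : ∀ j, |t j| ≤ 1) (hu : ∀ i, |u i| ≤ 1) :
    |2 * ∑ i, (1 + u i) * W₂ k i * (W₁ *ᵥ t) i| ≤ sdpTerm W₁ W₂ := by
  have hpos := two_mul_sum_le_sdpMax_Q (W₂ k) W₁ ht hu
  have hneg := two_mul_sum_le_sdpMax_Q (-W₂ k) W₁ ht hu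
  simp only [← neg_Q, Pi.neg_apply, mul_neg, neg_mul, Finset.sum_neg_distrib] at hneg
  have hmax : max (sdpMax (Q (W₂ k) W₁)) (sdpMax (-Q (W₂ k) W₁)) ≤ sdpTerm W₁ W₂ :=
    Finite.le_ciSup (fun k => max (sdpMax (Q (W₂ k) W₁)) (sdpMax (-Q (W₂ k) W₁))) k
  exact (abs_le'.2 ⟨hpos.trans (le_max_left _ _), hneg.trans (le_max_right _ _)⟩).trans hmax

variable {W₁ W₂}

lemma abs_apply_le_normTwoOne_transpose (k : Fin K) (i : Fin d₁) : |W₂ k i| ≤ normTwoOne W₂ᵀ := by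
  calc |W₂ k i| ≤ √(∑ i, W₂ k i ^ 2) :=
        Real.abs_le_sqrt (Finset.single_le_sum (f := fun i => W₂ k i ^ 2)
          (fun _ _ => sq_nonneg _) (Finset.mem_univ i))
    _ ≤ normTwoOne W₂ᵀ :=
        Finset.single_le_sum (f := fun k => √(∑ i, W₂ k i ^ 2)) (fun _ _ => Real.sqrt_nonneg _)
          (Finset.mem_univ k)

lemma InClass.sdpTerm_le {s₁ s₂ b₁ b₂ : ℝ} (h : InClass s₁ s₂ b₁ b₂ W₁ W₂) :
    sdpTerm W₁ W₂ ≤ 4 * b₁ * b₂ := by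
  have hb₁ := h.b₁_nonneg
  have hb₂ := h.b₂_nonneg
  have hQ : ∀ v : Fin d₁ → ℝ, (∀ i, |v i| ≤ b₂) → sdpMax (Q v W₁) ≤ 4 * b₁ * b₂ := by
    intro v hv
    calc sdpMax (Q v W₁) ≤ 4 * ∑ i, ∑ j, |v i| * |W₁ i j| := sdpMax_Q_le v W₁
      _ ≤ 4 * ∑ i, ∑ j, b₂ * |W₁ i j| := by
          gcongr with i _ j _
          exact hv i
      _ = 4 * (b₂ * entryNormOne W₁) := by simp only [entryNormOne, Finset.mul_sum]
      _ ≤ 4 * (b₂ * b₁) := by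
          gcongr
          exact h.2.2.1
      _ = 4 * b₁ * b₂ := by ring
  have hrow : ∀ k i, |W₂ k i| ≤ b₂ := fun k i =>
    (abs_apply_le_normTwoOne_transpose k i).trans h.2.2.2
  refine Real.iSup_le (fun k => max_le (hQ _ (hrow k)) ?_) (by positivity)
  rw [neg_Q]
  exact hQ _ fun i => by simpa using hrow k i

end Sdp

/-! ### Margins under perturbation -/

section Margin

variable {d d₁ K : ℕ}

/-- The slope of a secant of the positive part lies in `[0, 1]`; it is centered here, so that it
becomes the coordinate of a feasible point of the semidefinite program. -/
lemma exists_max_zero_sub_max_zero_eq (a b : ℝ) :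
    ∃ u : ℝ, |u| ≤ 1 ∧ max a 0 - max b 0 = (1 + u) / 2 * (a - b) := by
  have hmem : max a 0 - max b 0 ∈ segment ℝ 0 (a - b) := by
    rw [segment_eq_uIcc, Set.mem_uIcc]
    rcases le_total a b with h | h
    · right
      constructor <;>
        rcases max_cases a 0 with ha | ha <;> rcases max_cases b 0 with hb | hb <;> linarith
    · left
      constructor <;>
        rcases max_cases a 0 with ha | ha <;> rcases max_cases b 0 with hb | hb <;> linarith
  obtain ⟨p, q, hp, hq, hpq, h⟩ := hmem
  refine ⟨2 * q - 1, abs_le.2 ⟨by linarith, by linarith⟩, ?_⟩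
  rw [← h, smul_zero, zero_add, smul_eq_mul]
  ring

open scoped Pointwise in
lemma exists_eq_add_smul_of_mem_closedBall {ε : ℝ} {x x' : Fin d → ℝ}
    (hx : x' ∈ Metric.closedBall x ε) : ∃ t : Fin d → ℝ, (∀ j, |t j| ≤ 1) ∧ x' = x + ε • t := by
  have hε : 0 ≤ ε := dist_nonneg.trans hx
  have hsub : x' - x ∈ ε • Metric.closedBall (0 : Fin d → ℝ) 1 := by
    rwa [smul_unitClosedBall, Real.norm_of_nonneg hε, mem_closedBall_zero_iff, ← dist_eq_norm]
  obtain ⟨t, ht, hxt⟩ := hsub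
  exact ⟨t, (pi_norm_le_iff_of_nonneg zero_le_one).1 (mem_closedBall_zero_iff.1 ht),
    (add_eq_of_eq_sub' hxt).symm⟩

lemma abs_net_sub_net_le (W₁ : Matrix (Fin d₁) (Fin d) ℝ) (W₂ : Matrix (Fin K) (Fin d₁) ℝ)
    {ε : ℝ} {x x' : Fin d → ℝ} (hx : x' ∈ Metric.closedBall x ε) (k : Fin K) :
    |net W₁ W₂ x' k - net W₁ W₂ x k| ≤ ε / 4 * sdpTerm W₁ W₂ := by
  have hε : 0 ≤ ε := dist_nonneg.trans hx
  obtain ⟨t, ht, rfl⟩ := exists_eq_add_smul_of_mem_closedBall hx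
  choose u hu hslope using fun i =>
    exists_max_zero_sub_max_zero_eq ((W₁ *ᵥ (x + ε • t)) i) ((W₁ *ᵥ x) i)
  have hnet : net W₁ W₂ (x + ε • t) k - net W₁ W₂ x k =
      ε / 4 * (2 * ∑ i, (1 + u i) * W₂ k i * (W₁ *ᵥ t) i) := by
    calc _ = ∑ i, W₂ k i * (max ((W₁ *ᵥ (x + ε • t)) i) 0 - max ((W₁ *ᵥ x) i) 0) := by
          simp only [net, Matrix.mulVec, dotProduct, mul_sub, Finset.sum_sub_distrib]
      _ = ε / 4 * (2 * ∑ i, (1 + u i) * W₂ k i * (W₁ *ᵥ t) i) := by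
          simp only [hslope, Finset.mul_sum]
          refine Finset.sum_congr rfl fun i _ => ?_
          rw [Matrix.mulVec_add, Matrix.mulVec_smul, Pi.add_apply, Pi.smul_apply, smul_eq_mul]
          ring
  rw [hnet, abs_mul, abs_of_nonneg (by positivity)]
  gcongr
  exact abs_two_mul_sum_le_sdpTerm W₁ W₂ k ht hu

/-- The margin `z_y - max_{y' ≠ y} z_{y'}` of the scores `z` at the label `y`. -/
noncomputable def margin (z : Fin K → ℝ) (y : Fin K) : ℝ := z y - maxOther z y

variable [Nontrivial (Fin K)]

lemma abs_maxOther_sub_le {z z' : Fin K → ℝ} {y : Fin K} {r : ℝ}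
    (h : ∀ k ≠ y, |z k - z' k| ≤ r) : |maxOther z y - maxOther z' y| ≤ r := by
  have : Nonempty {k : Fin K // k ≠ y} := nonempty_subtype.2 (exists_ne y)
  exact abs_ciSup_sub_ciSup_le fun k : {k : Fin K // k ≠ y} => h k k.2

lemma margin_sub_le_zero_of_mem_advError {W₁ : Matrix (Fin d₁) (Fin d) ℝ}
    {W₂ : Matrix (Fin K) (Fin d₁) ℝ} {ε : ℝ} {p : (Fin d → ℝ) × Fin K}
    (hp : p ∈ advError (net W₁ W₂) ε) :
    margin (net W₁ W₂ p.1) p.2 - ε / 2 * sdpTerm W₁ W₂ ≤ 0 := by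
  obtain ⟨x', hx', hmis⟩ := hp
  have hnet := abs_net_sub_net_le W₁ W₂ hx'
  have hy := abs_le.1 (hnet p.2)
  have hother := abs_le.1 (abs_maxOther_sub_le (y := p.2) fun k _ => hnet k)
  have hmargin : net W₁ W₂ x' p.2 - maxOther (net W₁ W₂ x') p.2 ≤ 0 := not_lt.1 hmis
  rw [margin]
  linarith

end Margin

/-! ### Rademacher complexity of the margins -/

section MarginComplexity

section MarginMap

variable {S : Type*} {K : ℕ}

lemma margin_zero (y : Fin K) : margin (0 : Fin K → ℝ) y = 0 := by
  simp [margin, maxOther]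

/-- The vector of the margins of a family of score vectors. -/
noncomputable def marginMap (y : S → Fin K) (f : EuclideanSpace ℝ (S × Fin K)) :
    EuclideanSpace ℝ S :=
  WithLp.toLp 2 fun s => margin (fun k => f (s, k)) (y s)

lemma marginMap_zero (y : S → Fin K) : marginMap y (0 : EuclideanSpace ℝ (S × Fin K)) = 0 := by
  ext s
  exact margin_zero (y s)

variable [Fintype S] [Nontrivial (Fin K)]

lemma margin_sub_sq_le (z z' : Fin K → ℝ) (y : Fin K) :
    (margin z y - margin z' y) ^ 2 ≤ 2 * ∑ k, (z k - z' k) ^ 2 := by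
  set r := √(∑ k ∈ Finset.univ.erase y, (z k - z' k) ^ 2)
  have hr : r ^ 2 = ∑ k ∈ Finset.univ.erase y, (z k - z' k) ^ 2 := Real.sq_sqrt (by positivity)
  have hother : |maxOther z y - maxOther z' y| ≤ r := abs_maxOther_sub_le fun k hk =>
    Real.abs_le_sqrt (Finset.single_le_sum (f := fun k => (z k - z' k) ^ 2)
      (fun _ _ => sq_nonneg _) (Finset.mem_erase.2 ⟨hk, Finset.mem_univ k⟩))
  calc (margin z y - margin z' y) ^ 2
      = ((z y - z' y) - (maxOther z y - maxOther z' y)) ^ 2 := by rw [margin, margin]; ring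
    _ ≤ 2 * ((z y - z' y) ^ 2 + (maxOther z y - maxOther z' y) ^ 2) := by
        linarith [sq_nonneg ((z y - z' y) + (maxOther z y - maxOther z' y))]
    _ ≤ 2 * ((z y - z' y) ^ 2 + r ^ 2) := by
        linarith [sq_le_sq' (abs_le.1 hother).1 (abs_le.1 hother).2]
    _ = 2 * ∑ k, (z k - z' k) ^ 2 := by
        rw [hr, Finset.add_sum_erase _ (fun k => (z k - z' k) ^ 2) (Finset.mem_univ y)]

lemma norm_marginMap_sub_le (y : S → Fin K) (f f' : EuclideanSpace ℝ (S × Fin K)) :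
    ‖marginMap y f - marginMap y f'‖ ≤ √2 * ‖f - f'‖ := by
  refine le_of_sq_le_sq ?_ (by positivity)
  rw [mul_pow, Real.sq_sqrt zero_le_two, EuclideanSpace.real_norm_sq_eq,
    EuclideanSpace.real_norm_sq_eq, Fintype.sum_prod_type, Finset.mul_sum]
  exact Finset.sum_le_sum fun s _ =>
    margin_sub_sq_le (fun k => f (s, k)) (fun k => f' (s, k)) (y s)

lemma norm_marginMap_le (y : S → Fin K) (f : EuclideanSpace ℝ (S × Fin K)) :
    ‖marginMap y f‖ ≤ √2 * ‖f‖ := by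
  simpa [marginMap_zero] using norm_marginMap_sub_le y f 0

end MarginMap

lemma log_card_choices_le {p q m : ℕ} (hm : 0 < m) (hp : p ≤ m) (hq : q ≤ m) (k : ℕ) :
    Real.log (Fintype.card (Fin k → Option ((Fin p × Fin q) × Bool))) ≤
      k * (2 * Real.log (2 * m)) := by
  have hcard : p * q * 2 + 1 ≤ (2 * m) ^ 2 := by nlinarith [Nat.mul_le_mul hp hq]
  calc Real.log (Fintype.card (Fin k → Option ((Fin p × Fin q) × Bool)))
      = k * Real.log (p * q * 2 + 1 : ℕ) := by
        simp [Fintype.card_option, Real.log_pow]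
    _ ≤ k * Real.log ((2 * m) ^ 2 : ℕ) := by
        gcongr
    _ = k * (2 * Real.log (2 * m)) := by
        push_cast
        rw [Real.log_pow, Nat.cast_ofNat]

lemma log_card_prod_choices_le {d d₁ K : ℕ} (hK : 0 < K) (k : ℕ) :
    Real.log (Fintype.card ((Fin k → Option ((Fin d₁ × Fin d) × Bool)) ×
      (Fin k → Option ((Fin K × Fin d₁) × Bool)))) ≤
    2 * k * (2 * Real.log (2 * (max d (max d₁ K) : ℕ))) := by
  have hm : 0 < max d (max d₁ K) := by omega
  rw [Fintype.card_prod, Nat.cast_mul,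
    Real.log_mul (Nat.cast_ne_zero.2 Fintype.card_ne_zero)
      (Nat.cast_ne_zero.2 Fintype.card_ne_zero)]
  linarith [log_card_choices_le hm (p := d₁) (q := d) (by omega) (by omega) k,
    log_card_choices_le hm (p := K) (q := d₁) (by omega) (by omega) k]

lemma four_thirds_le_log {x : ℝ} (hx : 4 ≤ x) : 4 / 3 ≤ Real.log x := by
  have hlog4 : Real.log 4 = 2 * Real.log 2 := by
    rw [show (4 : ℝ) = 2 ^ 2 by norm_num, Real.log_pow, Nat.cast_ofNat]
  linarith [Real.log_two_gt_d9, Real.log_le_log (by norm_num) hx]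

lemma sqrt_four_pow (j : ℕ) : √((4 : ℝ) ^ j) = 2 ^ j := by
  rw [show (4 : ℝ) = 2 ^ 2 by norm_num, pow_right_comm, Real.sqrt_sq (by positivity)]

lemma exists_sqrt_div_two_pow_le_one {n : ℕ} (hn : 4 ≤ n) :
    ∃ N : ℕ, √(n : ℝ) / 2 ^ N ≤ 1 ∧ (N : ℝ) ≤ 3 / 2 * Real.log n := by
  refine ⟨Nat.clog 4 n, ?_, ?_⟩
  · rw [div_le_one (by positivity), ← sqrt_four_pow]
    exact Real.sqrt_le_sqrt (mod_cast Nat.le_pow_clog (by norm_num) n)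
  · have hclog : Nat.clog 4 n ≤ 2 * Nat.log 4 n := by
      have := Nat.clog_le_of_le_pow (Nat.lt_pow_succ_log_self (b := 4) (by norm_num) n).le
      have := Nat.log_pos (b := 4) (by norm_num) hn
      omega
    have hlog : Nat.log 4 n * Real.log 4 ≤ Real.log n := by
      rw [← Real.log_pow]
      exact Real.log_le_log (by positivity) (mod_cast Nat.pow_log_le_self 4 (by omega))
    have hlog4 : Nat.log 4 n * (4 / 3 : ℝ) ≤ Nat.log 4 n * Real.log 4 := by
      gcongr
      exact four_thirds_le_log le_rfl
    have hclog' : (Nat.clog 4 n : ℝ) ≤ 2 * Nat.log 4 n := mod_cast hclog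
    linarith

lemma chaining_constant_le {a l N q : ℝ} (ha : 4 / 3 ≤ a) (hl : 4 / 3 ≤ l)
    (hN : N ≤ 3 / 2 * l) (hq : q ≤ 1) :
    √2 * ((4 + 27 / 4 * N) * √(2 * a) + q) ≤ 30 * l * a := by
  have hsqrt2 : √2 ≤ (5 / 3 : ℝ) := Real.sqrt_le_iff.2 ⟨by norm_num, by norm_num⟩
  have hsqrt : √(2 * a) ≤ 5 / 4 * a := Real.sqrt_le_iff.2 ⟨by positivity, by nlinarith⟩
  have hla : 16 / 9 ≤ l * a := by nlinarith
  calc √2 * ((4 + 27 / 4 * N) * √(2 * a) + q)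
      ≤ √2 * ((3 * l + 81 / 8 * l) * (5 / 4 * a) + 1) := by
        gcongr ?_ * (?_ * ?_ + ?_)
        linarith
    _ ≤ √2 * (18 * (l * a)) := by
        gcongr
        linarith
    _ ≤ 5 / 3 * (18 * (l * a)) := by gcongr
    _ = 30 * l * a := by ring

lemma norm_toLp_eq_frobData {d n : ℕ} (x : Fin n → Fin d → ℝ) :
    ‖(WithLp.toLp 2 fun q => x q.1 q.2 : EuclideanSpace ℝ (Fin n × Fin d))‖ = frobData x := by
  simp [EuclideanSpace.norm_eq, Fintype.sum_prod_type, frobData]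

lemma rademacherSup_margin_le {ι : Type*} [Finite ι] [Nonempty ι] {d d₁ K n : ℕ}
    [Nontrivial (Fin K)] (hn : 4 ≤ n) {s₁ s₂ b₁ b₂ : ℝ} {W₁ : ι → Matrix (Fin d₁) (Fin d) ℝ}
    {W₂ : ι → Matrix (Fin K) (Fin d₁) ℝ} (hW : ∀ i, InClass s₁ s₂ b₁ b₂ (W₁ i) (W₂ i))
    (x : Fin n → Fin d → ℝ) (y : Fin n → Fin K) :
    rademacherSup (fun i s => margin (net (W₁ i) (W₂ i) (x s)) (y s)) ≤
      30 * Real.log n * Real.log (2 * (max d (max d₁ K) : ℕ)) *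
        ((s₂ * b₁ + s₁ * b₂) * frobData x) := by
  have hK : 2 ≤ K := Fin.nontrivial_iff_two_le.1 inferInstance
  set L := Real.log (2 * (max d (max d₁ K) : ℕ))
  have hL : 4 / 3 ≤ L := four_thirds_le_log <| by
    exact_mod_cast (by omega : 4 ≤ 2 * max d (max d₁ K))
  have hlog : 4 / 3 ≤ Real.log n := four_thirds_le_log (mod_cast hn)
  rw [← norm_toLp_eq_frobData]
  set X : EuclideanSpace ℝ (Fin n × Fin d) := WithLp.toLp 2 fun q => x q.1 q.2
  set B := (s₂ * b₁ + s₁ * b₂) * ‖X‖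
  have hB : ∀ i, ‖netMap (W₁ i) (W₂ i) X‖ ≤ B := fun i => by
    have := mul_nonneg (mul_nonneg (hW i).s₁_nonneg (hW i).b₂_nonneg) (norm_nonneg X)
    linarith [(hW i).norm_netMap_le X]
  have hB₀ : 0 ≤ B := (norm_nonneg _).trans (hB (Classical.arbitrary ι))
  obtain ⟨N, hN, hNlog⟩ := exists_sqrt_div_two_pow_le_one hn
  choose p hp using fun (j : ℕ) i => (hW i).exists_norm_sub_coverCenter_le X (pow_pos four_pos j)
  have hchain := rademacherSup_le_of_coverings (B := √2 * B) (a := 2 * L) (p := p)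
    (v := fun i => marginMap y (netMap (W₁ i) (W₂ i) X))
    (c := fun j g => marginMap y (coverCenter s₁ b₁ b₂ X (4 ^ j) g)) (by positivity) (by positivity)
    (fun i => (norm_marginMap_le y _).trans (by gcongr; exact hB i))
    (fun j i => by
      refine (norm_marginMap_sub_le y _ _).trans ?_
      rw [mul_div_assoc, ← sqrt_four_pow]
      gcongr
      exact mod_cast hp j i)
    (fun j => by
      simpa only [Nat.cast_pow, Nat.cast_ofNat] using
        log_card_prod_choices_le (d := d) (d₁ := d₁) (K := K) (by omega) (4 ^ j)) N
  rw [Fintype.card_fin] at hchain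
  calc _ ≤ √2 * B * ((4 + 27 / 4 * N) * √(2 * L) + √n / 2 ^ N) := hchain
    _ = √2 * ((4 + 27 / 4 * N) * √(2 * L) + √n / 2 ^ N) * B := by ring
    _ ≤ 30 * Real.log n * L * B :=
        mul_le_mul_of_nonneg_right (chaining_constant_le hL hlog hNlog hN) hB₀

end MarginComplexity

/-! ### The ramp loss of the network class -/

section RampLoss

/-- The ramp function: `1` on `(-∞, 0]`, `0` on `[γ, ∞)` and linear in between. It interpolates
between the adversarial error and the surrogate error. -/
noncomputable def ramp (γ m : ℝ) : ℝ := max 0 (min 1 (1 - m / γ))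

lemma ramp_mem_Icc (γ m : ℝ) : ramp γ m ∈ Set.Icc (0 : ℝ) 1 :=
  ⟨le_max_left _ _, max_le zero_le_one (min_le_left _ _)⟩

lemma ramp_of_nonpos {γ m : ℝ} (hγ : 0 ≤ γ) (hm : m ≤ 0) : ramp γ m = 1 := by
  have : m / γ ≤ 0 := div_nonpos_of_nonpos_of_nonneg hm hγ
  rw [ramp, min_eq_left (by linarith), max_eq_right zero_le_one]

lemma ramp_of_le {γ m : ℝ} (hγ : 0 < γ) (hm : γ ≤ m) : ramp γ m = 0 := by
  have : 1 ≤ m / γ := (one_le_div hγ).2 hm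
  exact max_eq_left ((min_le_right _ _).trans (by linarith))

lemma abs_ramp_sub_le (γ m m' : ℝ) : |ramp γ m - ramp γ m'| ≤ |γ⁻¹ * m - γ⁻¹ * m'| := by
  calc |ramp γ m - ramp γ m'| ≤ |min 1 (1 - m / γ) - min 1 (1 - m' / γ)| := by
        simpa [ramp] using abs_max_sub_max_le_max 0 (min 1 (1 - m / γ)) 0 (min 1 (1 - m' / γ))
    _ ≤ |1 - m / γ - (1 - m' / γ)| := by
        simpa using abs_min_sub_min_le_max 1 (1 - m / γ) 1 (1 - m' / γ)
    _ = |γ⁻¹ * m - γ⁻¹ * m'| := by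
        rw [sub_sub_sub_cancel_left, abs_sub_comm, div_eq_inv_mul, div_eq_inv_mul]

lemma continuous_ramp (γ : ℝ) : Continuous (ramp γ) := by
  unfold ramp
  fun_prop

variable {d d₁ K n : ℕ}

lemma continuous_net :
    Continuous fun p : Matrix (Fin d₁) (Fin d) ℝ × Matrix (Fin K) (Fin d₁) ℝ × (Fin d → ℝ) =>
      net p.1 p.2.1 p.2.2 :=
  continuous_snd.fst.matrix_mulVec <| continuous_pi fun j =>
    ((continuous_apply j).comp (continuous_fst.matrix_mulVec continuous_snd.snd)).max
      continuous_const

/-- The ramp loss at `q` of the network `(W₁, W₂)` with margin reduced by `e * c`, where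
`θ = (W₁, W₂, c)`. -/
noncomputable def rampLoss (γ e : ℝ)
    (θ : Matrix (Fin d₁) (Fin d) ℝ × Matrix (Fin K) (Fin d₁) ℝ × ℝ)
    (q : (Fin d → ℝ) × Fin K) : ℝ :=
  ramp γ (margin (net θ.1 θ.2.1 q.1) q.2 - e * θ.2.2)

lemma mean_rampLoss_le_surrogateError {γ : ℝ} (hγ : 0 < γ) (ε : ℝ)
    (W₁ : Matrix (Fin d₁) (Fin d) ℝ) (W₂ : Matrix (Fin K) (Fin d₁) ℝ)
    (S : Fin n → (Fin d → ℝ) × Fin K) :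
    (∑ k, rampLoss γ (ε / 2) (W₁, W₂, sdpTerm W₁ W₂) (S k)) / n ≤ surrogateError ε γ W₁ W₂ S := by
  rw [surrogateError, one_div_mul_eq_div]
  gcongr with k
  split_ifs with h
  · exact (ramp_mem_Icc _ _).2
  · refine (ramp_of_le hγ ?_).le
    rw [margin]
    linarith

variable [Nontrivial (Fin K)]

lemma continuous_margin (y : Fin K) : Continuous fun z : Fin K → ℝ => margin z y := by
  have hother : LipschitzWith 1 fun z : Fin K → ℝ => maxOther z y :=
    LipschitzWith.of_dist_le_mul fun z z' => by
      rw [Real.dist_eq, NNReal.coe_one, one_mul]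
      exact abs_maxOther_sub_le fun k _ => dist_le_pi_dist z z' k
  exact (continuous_apply y).sub hother.continuous

lemma measurable_margin_net (W₁ : Matrix (Fin d₁) (Fin d) ℝ) (W₂ : Matrix (Fin K) (Fin d₁) ℝ) :
    Measurable fun q : (Fin d → ℝ) × Fin K => margin (net W₁ W₂ q.1) q.2 :=
  measurable_from_prod_countable_left fun y =>
    ((continuous_margin y).comp <| continuous_net.comp <| continuous_const.prodMk <|
      continuous_const.prodMk continuous_id).measurable

lemma continuous_rampLoss (γ e : ℝ) (q : (Fin d → ℝ) × Fin K) :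
    Continuous fun θ : Matrix (Fin d₁) (Fin d) ℝ × Matrix (Fin K) (Fin d₁) ℝ × ℝ =>
      rampLoss γ e θ q := by
  have hnet : Continuous fun θ : Matrix (Fin d₁) (Fin d) ℝ × Matrix (Fin K) (Fin d₁) ℝ × ℝ =>
      net θ.1 θ.2.1 q.1 :=
    continuous_net.comp (continuous_fst.prodMk (continuous_snd.fst.prodMk continuous_const))
  exact (continuous_ramp γ).comp
    (((continuous_margin q.2).comp hnet).sub (continuous_snd.snd.const_mul e))

lemma measurable_rampLoss (γ e : ℝ)
    (θ : Matrix (Fin d₁) (Fin d) ℝ × Matrix (Fin K) (Fin d₁) ℝ × ℝ) :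
    Measurable (rampLoss γ e θ) :=
  (continuous_ramp γ).measurable.comp ((measurable_margin_net θ.1 θ.2.1).sub_const _)

lemma measureReal_advError_le_integral_rampLoss (D : Measure ((Fin d → ℝ) × Fin K))
    [IsFiniteMeasure D] {γ : ℝ} (hγ : 0 ≤ γ) (ε : ℝ) (W₁ : Matrix (Fin d₁) (Fin d) ℝ)
    (W₂ : Matrix (Fin K) (Fin d₁) ℝ) :
    D.real (advError (net W₁ W₂) ε) ≤
      ∫ q, rampLoss γ (ε / 2) (W₁, W₂, sdpTerm W₁ W₂) q ∂D := by
  set A : Set ((Fin d → ℝ) × Fin K) :=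
    {p | margin (net W₁ W₂ p.1) p.2 - ε / 2 * sdpTerm W₁ W₂ ≤ 0}
  have hA : MeasurableSet A :=
    measurableSet_le ((measurable_margin_net W₁ W₂).sub_const _) measurable_const
  have hloss : Integrable (rampLoss γ (ε / 2) (W₁, W₂, sdpTerm W₁ W₂)) D :=
    Integrable.of_mem_Icc 0 1 (measurable_rampLoss _ _ _).aemeasurable
      (.of_forall fun _ => ramp_mem_Icc _ _)
  calc D.real (advError (net W₁ W₂) ε) ≤ D.real A :=
        measureReal_mono fun _ => margin_sub_le_zero_of_mem_advError
    _ = ∫ q, A.indicator 1 q ∂D := (integral_indicator_one hA).symm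
    _ ≤ ∫ q, rampLoss γ (ε / 2) (W₁, W₂, sdpTerm W₁ W₂) q ∂D :=
        integral_mono ((integrable_const (1 : ℝ)).indicator hA) hloss <|
          Set.indicator_le' (fun _ hq => (ramp_of_nonpos hγ hq).ge) fun _ _ => (ramp_mem_Icc _ _).1

end RampLoss

/-! ### Robust generalization -/

section Generalization

variable {d d₁ K n : ℕ} {ε s₁ s₂ b₁ b₂ γ δ : ℝ}

/-- The bound on the Rademacher averages of the ramp losses for `n` data points of total Frobenius
norm `F` and layers of width at most `m`. The second summand is the cost of the free parameter that
replaces the semidefinite term. -/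
noncomputable def rampComplexity (m n : ℕ) (ε s₁ s₂ b₁ b₂ γ F : ℝ) : ℝ :=
  γ⁻¹ * (30 * Real.log n * Real.log (2 * m) * ((s₂ * b₁ + s₁ * b₂) * F) + ε * b₁ * b₂ * √n)

/-- The networks of the class, paired with a free parameter ranging over the possible values of the
semidefinite term. -/
def paramSet (d d₁ K : ℕ) (s₁ s₂ b₁ b₂ : ℝ) :
    Set (Matrix (Fin d₁) (Fin d) ℝ × Matrix (Fin K) (Fin d₁) ℝ × ℝ) :=
  {θ | InClass s₁ s₂ b₁ b₂ θ.1 θ.2.1 ∧ θ.2.2 ∈ Set.Icc 0 (4 * b₁ * b₂)}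

lemma InClass.mk_sdpTerm_mem_paramSet {W₁ : Matrix (Fin d₁) (Fin d) ℝ}
    {W₂ : Matrix (Fin K) (Fin d₁) ℝ} (h : InClass s₁ s₂ b₁ b₂ W₁ W₂) :
    (W₁, W₂, sdpTerm W₁ W₂) ∈ paramSet d d₁ K s₁ s₂ b₁ b₂ :=
  ⟨h, sdpTerm_nonneg W₁ W₂, h.sdpTerm_le⟩

instance : SecondCountableTopology (paramSet d d₁ K s₁ s₂ b₁ b₂) :=
  have : SecondCountableTopology (Matrix (Fin d₁) (Fin d) ℝ × Matrix (Fin K) (Fin d₁) ℝ × ℝ) :=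
    inferInstanceAs (SecondCountableTopology ((Fin d₁ → Fin d → ℝ) × (Fin K → Fin d₁ → ℝ) × ℝ))
  inferInstance

lemma measurable_rampComplexity_frobData {Y : Type*} [MeasurableSpace Y]
    (m : ℕ) (ε s₁ s₂ b₁ b₂ γ : ℝ) :
    Measurable fun S : Fin n → (Fin d → ℝ) × Y =>
      rampComplexity m n ε s₁ s₂ b₁ b₂ γ (frobData fun i => (S i).1) := by
  unfold rampComplexity frobData
  fun_prop

lemma rademacherSup_rampLoss_le [Nontrivial (Fin K)] {ι : Type*} [Finite ι] [Nonempty ι]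
    (hn : 4 ≤ n) (hε : 0 ≤ ε) (hγ : 0 < γ) (θ : ι → paramSet d d₁ K s₁ s₂ b₁ b₂)
    (S : Fin n → (Fin d → ℝ) × Fin K) :
    rademacherSup (fun i k => rampLoss γ (ε / 2) (θ i).1 (S k)) ≤
      rampComplexity (max d (max d₁ K)) n ε s₁ s₂ b₁ b₂ γ (frobData fun i => (S i).1) := by
  set u : ι → Fin n → ℝ := fun i k => margin (net (θ i).1.1 (θ i).1.2.1 (S k).1) (S k).2
  set v : ι → Fin n → ℝ := fun i _ => -(ε / 2 * (θ i).1.2.2)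
  have hmargin := rademacherSup_margin_le hn (fun i => (θ i).2.1) (fun k => (S k).1)
    fun k => (S k).2
  have hparam : rademacherSup v ≤ ε / 2 * (4 * b₁ * b₂) * √(Fintype.card (Fin n)) / 2 :=
    rademacherSup_neg_const_le fun i =>
      ⟨mul_nonneg (by positivity) (θ i).2.2.1,
        mul_le_mul_of_nonneg_left (θ i).2.2.2 (by positivity)⟩
  rw [Fintype.card_fin] at hparam
  calc rademacherSup (fun i k => rampLoss γ (ε / 2) (θ i).1 (S k))
      ≤ rademacherSup fun i k => γ⁻¹ * (u i k + v i k) :=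
        rademacherSup_le_of_contraction fun i j k => abs_ramp_sub_le _ _ _
    _ = γ⁻¹ * rademacherSup fun i k => u i k + v i k := rademacherSup_const_mul (by positivity) _
    _ ≤ γ⁻¹ * (rademacherSup u + rademacherSup v) := by
        gcongr
        exact rademacherSup_add_le u v
    _ ≤ rampComplexity (max d (max d₁ K)) n ε s₁ s₂ b₁ b₂ γ (frobData fun i => (S i).1) := by
        rw [rampComplexity]
        gcongr
        linarith

lemma three_mul_sqrt_mul_div_two_div_le (hn : 0 < n) (hδ₀ : 0 < δ) :
    3 * √(n * Real.log (1 / δ) / 2) / n ≤ 3 * √(Real.log (2 / δ) / (2 * n)) := by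
  have hn' : (0 : ℝ) < n := mod_cast hn
  have hsqrt : √(n * Real.log (1 / δ) / 2) = n * √(Real.log (1 / δ) / (2 * n)) := by
    rw [← Real.sqrt_sq hn'.le, ← Real.sqrt_mul (sq_nonneg _), Real.sqrt_sq hn'.le]
    congr 1
    field_simp
  rw [hsqrt, mul_left_comm, mul_div_cancel_left₀ _ hn'.ne']
  gcongr
  norm_num

lemma exists_measurableSet_forall_integral_rampLoss_le [Nontrivial (Fin K)]
    (D : Measure ((Fin d → ℝ) × Fin K)) [IsProbabilityMeasure D] (hn : 4 ≤ n) (hε : 0 ≤ ε)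
    (hγ : 0 < γ) (hδ₀ : 0 < δ) (hδ₁ : δ ≤ 1) :
    ∃ E : Set (Fin n → (Fin d → ℝ) × Fin K), MeasurableSet E ∧
      1 - δ ≤ (Measure.pi fun _ : Fin n => D).real E ∧
      ∀ S ∈ E, ∀ θ ∈ paramSet d d₁ K s₁ s₂ b₁ b₂,
        ∫ q, rampLoss γ (ε / 2) θ q ∂D ≤ (∑ k, rampLoss γ (ε / 2) θ (S k)) / n +
          2 * rampComplexity (max d (max d₁ K)) n ε s₁ s₂ b₁ b₂ γ (frobData fun i => (S i).1) / n +
          3 * √(Real.log (2 / δ) / (2 * n)) := by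
  have hn₀ : 0 < n := by omega
  have hn' : (0 : ℝ) < n := mod_cast hn₀
  obtain ⟨E, hE, hEδ, hbound⟩ := exists_measurableSet_forall_integral_le D
    (ℓ := fun θ : paramSet d d₁ K s₁ s₂ b₁ b₂ => rampLoss γ (ε / 2) θ.1)
    (fun θ => measurable_rampLoss _ _ _)
    (fun q => (continuous_rampLoss _ _ q).comp continuous_subtype_val)
    (fun θ q => ramp_mem_Icc _ _)
    (measurable_rampComplexity_frobData _ ε s₁ s₂ b₁ b₂ γ)
    (fun m θ S => rademacherSup_rampLoss_le hn hε hγ θ S) hn₀ hδ₀ hδ₁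
  refine ⟨E, hE, hEδ, fun S hS θ hθ => ?_⟩
  have h := (le_div_iff₀' hn').2 (hbound S hS ⟨θ, hθ⟩)
  simp only [add_div] at h
  linarith [three_mul_sqrt_mul_div_two_div_le hn₀ hδ₀]

lemma add_le_rpow_two_thirds_add_rpow {a b : ℝ} (ha : 0 ≤ a) (hb : 0 ≤ b) :
    a + b ≤ (a ^ (2 / 3 : ℝ) + b ^ (2 / 3 : ℝ)) ^ (3 / 2 : ℝ) := by
  have h := Real.add_rpow_le_rpow_add (Real.rpow_nonneg ha (2 / 3)) (Real.rpow_nonneg hb (2 / 3))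
    (p := 3 / 2) (by norm_num)
  rw [← Real.rpow_mul ha, ← Real.rpow_mul hb] at h
  norm_num at h
  exact h

lemma rampComplexity_nonneg {F : ℝ} (m n : ℕ) (hε : 0 ≤ ε) (hs₁ : 0 ≤ s₁) (hs₂ : 0 ≤ s₂)
    (hb₁ : 0 ≤ b₁) (hb₂ : 0 ≤ b₂) (hγ : 0 ≤ γ) (hF : 0 ≤ F) :
    0 ≤ rampComplexity m n ε s₁ s₂ b₁ b₂ γ F := by
  have := Real.log_natCast_nonneg n
  have : 0 ≤ Real.log (2 * m) := mod_cast Real.log_natCast_nonneg (2 * m)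
  unfold rampComplexity
  positivity

lemma two_mul_rampComplexity_div_le {F : ℝ} (m n : ℕ) (hs₁ : 0 < s₁) (hs₂ : 0 < s₂)
    (hb₁ : 0 ≤ b₁) (hb₂ : 0 ≤ b₂) (hγ : 0 < γ) (hF : 0 ≤ F) :
    2 * rampComplexity m n ε s₁ s₂ b₁ b₂ γ F / n ≤
      1 / γ * (4 / (n : ℝ) ^ (3 / 2 : ℝ) + 60 * Real.log n * Real.log (2 * m) / n * s₁ * s₂
        * ((b₁ / s₁) ^ (2 / 3 : ℝ) + (b₂ / s₂) ^ (2 / 3 : ℝ)) ^ (3 / 2 : ℝ) * F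
        + 2 * ε * b₁ * b₂ / √n) := by
  have := Real.log_natCast_nonneg n
  have : 0 ≤ Real.log (2 * m) := mod_cast Real.log_natCast_nonneg (2 * m)
  set A := ((b₁ / s₁) ^ (2 / 3 : ℝ) + (b₂ / s₂) ^ (2 / 3 : ℝ)) ^ (3 / 2 : ℝ)
  have hA : s₂ * b₁ + s₁ * b₂ ≤ s₁ * s₂ * A := by
    calc s₂ * b₁ + s₁ * b₂ = s₁ * s₂ * (b₁ / s₁ + b₂ / s₂) := by field_simp
      _ ≤ s₁ * s₂ * A := by
          gcongr
          exact add_le_rpow_two_thirds_add_rpow (by positivity) (by positivity)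
  calc 2 * rampComplexity m n ε s₁ s₂ b₁ b₂ γ F / n
      = 1 / γ * (60 * Real.log n * Real.log (2 * m) / n * (s₂ * b₁ + s₁ * b₂) * F
          + 2 * ε * b₁ * b₂ * (√n / n)) := by rw [rampComplexity]; ring
    _ ≤ 1 / γ * (60 * Real.log n * Real.log (2 * m) / n * (s₁ * s₂ * A) * F
          + 2 * ε * b₁ * b₂ * (√n / n)) := by gcongr
    _ = 1 / γ * (60 * Real.log n * Real.log (2 * m) / n * s₁ * s₂ * A * F
          + 2 * ε * b₁ * b₂ / √n) := by rw [Real.sqrt_div_self']; ring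
    _ ≤ _ := by
        gcongr
        exact le_add_of_nonneg_left (by positivity)

lemma surrogateError_nonneg (W₁ : Matrix (Fin d₁) (Fin d) ℝ) (W₂ : Matrix (Fin K) (Fin d₁) ℝ)
    (S : Fin n → (Fin d → ℝ) × Fin K) : 0 ≤ surrogateError ε γ W₁ W₂ S :=
  mul_nonneg (by positivity) (Finset.sum_nonneg fun i _ => by split_ifs <;> norm_num)

lemma one_le_three_mul_sqrt (hn : 0 < n) (hn' : n ≤ 3) (hδ₀ : 0 < δ) (hδ₁ : δ ≤ 1) :
    1 ≤ 3 * √(Real.log (2 / δ) / (2 * n)) := by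
  have hlog : Real.log 2 ≤ Real.log (2 / δ) :=
    Real.log_le_log two_pos (le_div_self zero_le_two hδ₀ hδ₁)
  have hcast : (n : ℝ) ≤ 3 := mod_cast hn'
  have hsqrt : (1 / 3 : ℝ) ≤ √(Real.log (2 / δ) / (2 * n)) := by
    refine Real.le_sqrt_of_sq_le ?_
    rw [le_div_iff₀ (by positivity)]
    linarith [Real.log_two_gt_d9]
  linarith

lemma exists_measurableSet_forall_measureReal_advError_le [Nontrivial (Fin K)]
    (D : Measure ((Fin d → ℝ) × Fin K)) [IsProbabilityMeasure D] (hn : 0 < n) (hε : 0 ≤ ε)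
    (hγ : 0 < γ) (hδ₀ : 0 < δ) (hδ₁ : δ ≤ 1) :
    ∃ E : Set (Fin n → (Fin d → ℝ) × Fin K), MeasurableSet E ∧
      1 - δ ≤ (Measure.pi fun _ : Fin n => D).real E ∧
      ∀ S ∈ E, ∀ (W₁ : Matrix (Fin d₁) (Fin d) ℝ) (W₂ : Matrix (Fin K) (Fin d₁) ℝ),
        InClass s₁ s₂ b₁ b₂ W₁ W₂ → D.real (advError (net W₁ W₂) ε) ≤
          surrogateError ε γ W₁ W₂ S +
          2 * rampComplexity (max d (max d₁ K)) n ε s₁ s₂ b₁ b₂ γ (frobData fun i => (S i).1) / n +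
          3 * √(Real.log (2 / δ) / (2 * n)) := by
  rcases Nat.lt_or_ge n 4 with hn4 | hn4
  · refine ⟨Set.univ, MeasurableSet.univ, by simp [hδ₀.le], fun S _ W₁ W₂ hW => ?_⟩
    have hcomplexity := rampComplexity_nonneg (max d (max d₁ K)) n hε hW.s₁_nonneg hW.s₂_nonneg
      hW.b₁_nonneg hW.b₂_nonneg hγ.le (Real.sqrt_nonneg _ : 0 ≤ frobData fun i => (S i).1)
    have hsurrogate := surrogateError_nonneg (ε := ε) (γ := γ) W₁ W₂ S
    calc D.real (advError (net W₁ W₂) ε) ≤ 1 := measureReal_le_one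
      _ ≤ 3 * √(Real.log (2 / δ) / (2 * n)) := one_le_three_mul_sqrt hn (by omega) hδ₀ hδ₁
      _ ≤ _ := le_add_of_nonneg_left (by positivity)
  · obtain ⟨E, hE, hEδ, hbound⟩ := exists_measurableSet_forall_integral_rampLoss_le (d₁ := d₁)
      (s₁ := s₁) (s₂ := s₂) (b₁ := b₁) (b₂ := b₂) D hn4 hε hγ hδ₀ hδ₁
    refine ⟨E, hE, hEδ, fun S hS W₁ W₂ hW => ?_⟩
    linarith [measureReal_advError_le_integral_rampLoss D hγ.le ε W₁ W₂,
      hbound S hS _ hW.mk_sdpTerm_mem_paramSet, mean_rampLoss_le_surrogateError hγ ε W₁ W₂ S]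

end Generalization

end AdvSDP

theorem theorem8 {d d₁ K n : ℕ} (hK : 2 ≤ K) (hn : 0 < n)
    (D : Measure ((Fin d → ℝ) × Fin K)) [IsProbabilityMeasure D]
    (ε s₁ s₂ b₁ b₂ γ δ : ℝ) (hε : 0 ≤ ε) (hs₁ : 0 < s₁) (hs₂ : 0 < s₂)
    (hγ : 0 < γ) (hδ₀ : 0 < δ) (hδ₁ : δ < 1) :
    ∃ E : Set (Fin n → (Fin d → ℝ) × Fin K), MeasurableSet E ∧
      1 - δ ≤ (Measure.pi fun _ : Fin n => D).real E ∧
      ∀ S ∈ E, ∀ (W₁ : Matrix (Fin d₁) (Fin d) ℝ) (W₂ : Matrix (Fin K) (Fin d₁) ℝ),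
        AdvSDP.InClass s₁ s₂ b₁ b₂ W₁ W₂ →
        D.real (AdvSDP.advError (AdvSDP.net W₁ W₂) ε) ≤
          AdvSDP.surrogateError ε γ W₁ W₂ S
          + 1 / γ * (4 / (n : ℝ) ^ (3 / 2 : ℝ)
            + 60 * Real.log n * Real.log (2 * (max d (max d₁ K) : ℕ)) / n * s₁ * s₂
              * ((b₁ / s₁) ^ (2 / 3 : ℝ) + (b₂ / s₂) ^ (2 / 3 : ℝ)) ^ (3 / 2 : ℝ)
              * AdvSDP.frobData (fun i => (S i).1)
            + 2 * ε * b₁ * b₂ / √n)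
          + 3 * √(Real.log (2 / δ) / (2 * n)) := by
  have : Nontrivial (Fin K) := Fin.nontrivial_iff_two_le.2 hK
  obtain ⟨E, hE, hEδ, hbound⟩ := AdvSDP.exists_measurableSet_forall_measureReal_advError_le
    (d₁ := d₁) (s₁ := s₁) (s₂ := s₂) (b₁ := b₁) (b₂ := b₂) D hn hε hγ hδ₀ hδ₁.le
  refine ⟨E, hE, hEδ, fun S hS W₁ W₂ hW => (hbound S hS W₁ W₂ hW).trans ?_⟩
  gcongr
  exact AdvSDP.two_mul_rampComplexity_div_le _ n hs₁ hs₂ hW.b₁_nonneg hW.b₂_nonneg hγ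
    (Real.sqrt_nonneg _)
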